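/- Conventions. An operator space is a complex Banach space $E$ with norms $\|\cdot\|_n$ on $M_n(E)$, $n\in\mathbb N$, that satisfy Ruan's axioms and extend the norm of $E=M_1(E)$. For operator spaces $E,F$ the Haagerup tensor product $E\otimes_h F$ is the completion of the algebraic tensor product with respect to the matrix norms $\|u\|_n=\inf\{\|x\|\,\|y\| : u=x\odot y,\ x\in M_{n,p}(E),\ y\in M_{p,n}(F),\ p\in\mathbb N\}$, where $(x\odot y)_{ij}=\sum_k x_{ik}\otimes y_{kj}$. A unital operator algebra $A$ is an operator space that is a unital Banach algebra with $\|1\|\le 1$ whose multiplication induces a complete contraction $A\otimes_h A\to A$. A right operator $A$-module is an operator space $E$ that is a unital right $A$-module whose action induces a complete contraction $E\otimes_h A\to E$. $\mathcal{OMOD}_A$ is the category of right operator $A$-modules and completely bounded $A$-module maps, and $\mathcal{O}p$ is the category of operator spaces and completely bounded linear maps. A kernel-cokernel pair in $\mathcal{OMOD}_A$ is a pair $(\mu,\pi)$ of composable morphisms such that $\mu$ is a kernel of $\pi$ and $\pi$ is a cokernel of $\mu$. $\mathcal{E}_{rel}$ is the class of all kernel-cokernel pairs $K\xrightarrow{\mu}E\xrightarrow{\pi}C$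 in $\mathcal{OMOD}_A$ that split in $\mathcal{O}p$, that is, for which there are completely bounded linear maps $\rho\colon E\to K$ and $\sigma\colon C\to E$ with $\rho\mu=\mathrm{id}_K$, $\pi\sigma=\mathrm{id}_C$ and $\mu\rho+\sigma\pi=\mathrm{id}_E$. $\mathcal{P}_{rel}$ is the class of admissible epimorphisms of $\mathcal{E}_{rel}$, that is, of the morphisms $\pi$ with $(\mu,\pi)\in\mathcal{E}_{rel}$ for some $\mu$. An object $X$ of $\mathcal{OMOD}_A$ is $\mathcal{P}_{rel}$-projective if for every $\pi\colon F\to G$ in $\mathcal{P}_{rel}$ and every morphism $f\colon X\to G$ there is a morphism $g\colon X\to F$ with $\pi g=f$. Proposition. Let $A$ be a unital operator algebra. 1. For every operator space $E$, the right operator $A$-module $E\otimes_h A$ with the action $(x\otimes a)\cdot b=x\otimes ab$ is $\mathcal{P}_{rel}$-projective. 2. For every right operator $A$-module $E$ there is a morphism $P\colon E\otimes_h A\to E$ in $\mathcal{OMOD}_A$ with $P(x\otimes a)=x\cdot a$ for all $x\in E$, $a\in A$, and $P\in\mathcal{P}_{rel}$. 3. $(\mathcal{OMOD}_A,\mathcal{E}_{rel})$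 has enough $\mathcal{P}_{rel}$-projectives: for every object $E$ of $\mathcal{OMOD}_A$ there are a $\mathcal{P}_{rel}$-projective object $X$ and a morphism $X\to E$ in $\mathcal{P}_{rel}$. -/

import Mathlib

open TensorProduct

set_option linter.unusedSectionVars false

universe u v w

namespace OperatorModules

section Scalars

open scoped Matrix.Norms.L2Operator

variable {ι κ : Type} [Fintype ι] [Fintype κ] [DecidableEq ι] [DecidableEq κ]

/-- The operator norm of a rectangular complex matrix, as a map between Euclidean spaces. -/
noncomputable def opNorm (α : Matrix ι κ ℂ) : ℝ := ‖α‖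

theorem opNorm_nonneg (α : Matrix ι κ ℂ) : 0 ≤ opNorm α := norm_nonneg _

theorem opNorm_mul {l : Type} [Fintype l] [DecidableEq l] (α : Matrix ι κ ℂ) (β : Matrix κ l ℂ) :
    opNorm (α * β) ≤ opNorm α * opNorm β := Matrix.l2_opNorm_mul α β

theorem opNorm_zero : opNorm (0 : Matrix ι κ ℂ) = 0 := norm_zero

theorem opNorm_one_le : opNorm (1 : Matrix ι ι ℂ) ≤ 1 := by
  unfold opNorm
  rw [← Matrix.diagonal_one, Matrix.l2_opNorm_diagonal]
  exact (pi_norm_le_iff_of_nonneg zero_le_one).2 fun i => by simp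

theorem opNorm_smul (c : ℂ) (α : Matrix ι κ ℂ) : opNorm (c • α) = ‖c‖ * opNorm α :=
  norm_smul c α

theorem opNorm_conjTranspose (α : Matrix ι κ ℂ) : opNorm α.conjTranspose = opNorm α :=
  Matrix.l2_opNorm_conjTranspose α

theorem opNorm_le_of_conjTranspose_mul {α : Matrix ι κ ℂ} {s : ℝ} (hs : 0 ≤ s)
    (h : opNorm (α.conjTranspose * α) ≤ s ^ 2) : opNorm α ≤ s := by
  unfold opNorm at *
  rw [Matrix.l2_opNorm_conjTranspose_mul_self] at h
  nlinarith [norm_nonneg α]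

theorem opNorm_le_of_mul_conjTranspose {α : Matrix ι κ ℂ} {s : ℝ} (hs : 0 ≤ s)
    (h : opNorm (α * α.conjTranspose) ≤ s ^ 2) : opNorm α ≤ s := by
  rw [← opNorm_conjTranspose]
  apply opNorm_le_of_conjTranspose_mul hs
  rwa [Matrix.conjTranspose_conjTranspose]

/-- The matrix of an injection of index sets. -/
noncomputable def sel (f : ι → κ) : Matrix ι κ ℂ := (1 : Matrix κ κ ℂ).submatrix f id

theorem sel_apply (f : ι → κ) (i : ι) (k : κ) : sel f i k = if f i = k then 1 else 0 := by
  simp [sel, Matrix.one_apply]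

theorem opNorm_sel_le {f : ι → κ} (hf : Function.Injective f) : opNorm (sel f) ≤ 1 := by
  apply opNorm_le_of_mul_conjTranspose zero_le_one
  have : sel f * (sel f).conjTranspose = (1 : Matrix ι ι ℂ) := by
    ext i j
    simp [Matrix.mul_apply, sel_apply, Matrix.one_apply, hf.eq_iff, eq_comm]
  rw [this]
  simpa using opNorm_one_le

theorem opNorm_selT_le {f : ι → κ} (hf : Function.Injective f) :
    opNorm (sel f).conjTranspose ≤ 1 := by
  rw [opNorm_conjTranspose]
  exact opNorm_sel_le hf

end Scalars

section Ruan

/-- `lr α x β` is the product `α x β` of a matrix `x` over a complex vector space with complex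
matrices `α` (on the left) and `β` (on the right). -/
noncomputable def lr {E : Type*} [AddCommGroup E] [Module ℂ E] {ι' ι κ κ' : Type} [Fintype ι]
    [Fintype κ] (α : Matrix ι' ι ℂ) (x : Matrix ι κ E) (β : Matrix κ κ' ℂ) : Matrix ι' κ' E :=
  Matrix.of fun i j => ∑ k, ∑ l, (α i k * β l j) • x k l

/-- The direct sum `x ⊕ y ∈ M_{m+n}(E)` of `x ∈ M_m(E)` and `y ∈ M_n(E)`. -/
def dsum {E : Type*} [Zero E] {m n : ℕ} (x : Matrix (Fin m) (Fin m) E)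
    (y : Matrix (Fin n) (Fin n) E) : Matrix (Fin (m + n)) (Fin (m + n)) E :=
  (Matrix.fromBlocks x 0 0 y).submatrix finSumFinEquiv.symm finSumFinEquiv.symm

/-- Matrix norms `‖·‖ₙ` on `M_n(E)`, `n ∈ ℕ`, that satisfy Ruan's axioms and extend the
norm of `E = M_1(E)`. That each `‖·‖ₙ` is a seminorm, and a norm if the norm of `E` is one,
follows from the axioms. An operator space is a Banach space with such matrix norms. -/
class MatrixNormed (E : Type*) [SeminormedAddCommGroup E] [NormedSpace ℂ E] where
  mnorm : ∀ {n : ℕ}, Matrix (Fin n) (Fin n) E → ℝ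
  mnorm_one : ∀ x : Matrix (Fin 1) (Fin 1) E, mnorm x = ‖x 0 0‖
  mnorm_add_le : ∀ {n : ℕ} (x y : Matrix (Fin n) (Fin n) E), mnorm (x + y) ≤ mnorm x + mnorm y
  mnorm_lr_le : ∀ {m n : ℕ} (α : Matrix (Fin n) (Fin m) ℂ) (x : Matrix (Fin m) (Fin m) E)
    (β : Matrix (Fin m) (Fin n) ℂ), mnorm (lr α x β) ≤ opNorm α * mnorm x * opNorm β
  mnorm_dsum : ∀ {m n : ℕ} (x : Matrix (Fin m) (Fin m) E) (y : Matrix (Fin n) (Fin n) E),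
    mnorm (dsum x y) = max (mnorm x) (mnorm y)

open MatrixNormed


section Algebra

variable {E : Type*} [AddCommGroup E] [Module ℂ E]
variable {ι ι' ι'' κ κ' κ'' : Type} [Fintype ι] [Fintype ι'] [Fintype ι''] [Fintype κ] [Fintype κ']
  [Fintype κ''] [DecidableEq ι] [DecidableEq ι'] [DecidableEq ι''] [DecidableEq κ] [DecidableEq κ']
  [DecidableEq κ'']

theorem lr_apply (α : Matrix ι' ι ℂ) (x : Matrix ι κ E) (β : Matrix κ κ' ℂ) (i : ι') (j : κ') :
    lr α x β i j = ∑ k, ∑ l, (α i k * β l j) • x k l := rfl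

theorem lr_lr (α : Matrix ι'' ι' ℂ) (α' : Matrix ι' ι ℂ) (x : Matrix ι κ E) (β' : Matrix κ κ' ℂ)
    (β : Matrix κ' κ'' ℂ) : lr α (lr α' x β') β = lr (α * α') x (β' * β) := by
  ext i j
  simp only [lr_apply, Matrix.mul_apply, Finset.smul_sum, Finset.sum_mul, Finset.mul_sum,
    Finset.sum_smul, smul_smul]
  have h1 : ∀ k : ι', (∑ l : κ', ∑ a : ι, ∑ b : κ, (α i k * β l j * (α' k a * β' b l)) • x a b)
      = ∑ a : ι, ∑ b : κ, ∑ l : κ', (α i k * β l j * (α' k a * β' b l)) • x a b := by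
    intro k
    rw [Finset.sum_comm]
    exact Finset.sum_congr rfl fun a _ => Finset.sum_comm
  simp only [h1]
  rw [Finset.sum_comm]
  refine Finset.sum_congr rfl fun a _ => ?_
  rw [Finset.sum_comm]
  refine Finset.sum_congr rfl fun b _ => ?_
  rw [Finset.sum_comm]
  refine Finset.sum_congr rfl fun l _ => Finset.sum_congr rfl fun k _ => ?_
  congr 1
  ring

theorem lr_sel (f : ι' → ι) (g : κ' → κ) (x : Matrix ι κ E) :
    lr (sel f) x (sel g).conjTranspose = x.submatrix f g := by
  ext i j
  simp [lr_apply, sel_apply, Matrix.conjTranspose_apply, ite_smul]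

theorem lr_one_one (x : Matrix ι κ E) : lr 1 x 1 = x := by
  ext i j
  simp [lr_apply, Matrix.one_apply, ite_smul]

theorem lr_add (α : Matrix ι' ι ℂ) (x y : Matrix ι κ E) (β : Matrix κ κ' ℂ) :
    lr α (x + y) β = lr α x β + lr α y β := by
  ext i j
  simp [lr_apply, Finset.sum_add_distrib]

theorem lr_smul_left (c : ℂ) (α : Matrix ι' ι ℂ) (x : Matrix ι κ E) (β : Matrix κ κ' ℂ) :
    lr (c • α) x β = c • lr α x β := by
  ext i j
  simp [lr_apply, Finset.smul_sum, smul_smul, mul_assoc]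

theorem lr_map {F : Type*} [AddCommGroup F] [Module ℂ F] (f : E →ₗ[ℂ] F)
    (α : Matrix ι' ι ℂ) (x : Matrix ι κ E) (β : Matrix κ κ' ℂ) :
    (lr α x β).map f = lr α (x.map f) β := by
  ext i j
  simp [lr_apply, map_sum]

theorem lr_one_right (α : Matrix ι' ι ℂ) (x : Matrix ι κ E) (i : ι') (k : κ) :
    lr α x (1 : Matrix κ κ ℂ) i k = ∑ a, α i a • x a k := by
  simp [lr_apply, Matrix.one_apply, ite_smul]

theorem lr_one_left (x : Matrix ι κ E) (β : Matrix κ κ' ℂ) (i : ι) (k : κ') :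
    lr (1 : Matrix ι ι ℂ) x β i k = ∑ a, β a k • x i a := by
  simp [lr_apply, Matrix.one_apply, ite_smul]

end Algebra

variable {E : Type*} [SeminormedAddCommGroup E] [NormedSpace ℂ E]
variable {ι ι' ι'' κ κ' κ'' : Type} [Fintype ι] [Fintype ι'] [Fintype ι''] [Fintype κ] [Fintype κ']
  [Fintype κ''] [DecidableEq ι] [DecidableEq ι'] [DecidableEq ι''] [DecidableEq κ] [DecidableEq κ']
  [DecidableEq κ'']

/-- The square matrix obtained from a rectangular one by adding zero rows and columns. -/
noncomputable def pad {E : Type*} [Zero E] {ι κ : Type} [Fintype ι] [Fintype κ]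
    (x : Matrix ι κ E) :
    Matrix (Fin (Fintype.card (ι ⊕ κ))) (Fin (Fintype.card (ι ⊕ κ))) E :=
  (Matrix.fromBlocks (0 : Matrix ι ι E) x 0 (0 : Matrix κ κ E)).submatrix
    (Fintype.equivFin (ι ⊕ κ)).symm (Fintype.equivFin (ι ⊕ κ)).symm

/-- The norm of a rectangular matrix over an operator space: the norm of the square matrix
obtained from it by adding zero rows and columns. -/
noncomputable def rnorm {E : Type*} [SeminormedAddCommGroup E] [NormedSpace ℂ E] [MatrixNormed E]
    {ι κ : Type} [Fintype ι] [Fintype κ] (x : Matrix ι κ E) : ℝ := mnorm (pad x)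

theorem pad_inl_inr (x : Matrix ι κ E) :
    (pad x).submatrix (fun i => Fintype.equivFin (ι ⊕ κ) (Sum.inl i))
      (fun j => Fintype.equivFin (ι ⊕ κ) (Sum.inr j)) = x := by
  ext i j
  simp [pad]

theorem pad_eq_lr (x : Matrix ι κ E) :
    pad x = lr (sel (fun i => Fintype.equivFin (ι ⊕ κ) (Sum.inl i))).conjTranspose x
      (sel (fun j => Fintype.equivFin (ι ⊕ κ) (Sum.inr j))) := by
  ext a b
  obtain ⟨a, rfl⟩ := (Fintype.equivFin (ι ⊕ κ)).surjective a
  obtain ⟨b, rfl⟩ := (Fintype.equivFin (ι ⊕ κ)).surjective b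
  rcases a with a | a <;> rcases b with b | b <;>
    simp [pad, lr_apply, sel_apply, Matrix.conjTranspose_apply, ite_smul]

theorem pad_add (x y : Matrix ι κ E) : pad (x + y) = pad x + pad y := by
  rw [pad_eq_lr, lr_add, ← pad_eq_lr, ← pad_eq_lr]

theorem injL : Function.Injective (fun i : ι => Fintype.equivFin (ι ⊕ κ) (Sum.inl i)) :=
  (Fintype.equivFin _).injective.comp Sum.inl_injective

theorem injR : Function.Injective (fun i : κ => Fintype.equivFin (ι ⊕ κ) (Sum.inr i)) :=
  (Fintype.equivFin _).injective.comp Sum.inr_injective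

variable [MatrixNormed E]

theorem mnorm_zero {n : ℕ} : mnorm (0 : Matrix (Fin n) (Fin n) E) = 0 := by
  have h1 : mnorm (0 : Matrix (Fin n) (Fin n) E) ≤ 0 := by
    have := mnorm_lr_le (0 : Matrix (Fin n) (Fin n) ℂ) (0 : Matrix (Fin n) (Fin n) E) 1
    have h0 : lr (0 : Matrix (Fin n) (Fin n) ℂ) (0 : Matrix (Fin n) (Fin n) E)
      (1 : Matrix (Fin n) (Fin n) ℂ) = 0 := by
      ext i j; simp [lr_apply]
    rw [h0, opNorm_zero] at this
    linarith
  have h2 := mnorm_add_le (0 : Matrix (Fin n) (Fin n) E) 0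
  rw [add_zero] at h2
  linarith

theorem mnorm_nonneg {n : ℕ} (x : Matrix (Fin n) (Fin n) E) : 0 ≤ mnorm x := by
  have h := mnorm_add_le x (-x)
  rw [add_neg_cancel, mnorm_zero] at h
  have key := mnorm_lr_le ((-1 : ℂ) • (1 : Matrix (Fin n) (Fin n) ℂ)) x 1
  rw [lr_smul_left, lr_one_one, opNorm_smul] at key
  simp only [neg_smul, one_smul, norm_neg, norm_one, one_mul] at key
  by_contra! hx
  have h2 := opNorm_nonneg (1 : Matrix (Fin n) (Fin n) ℂ)
  have h3 := mul_nonneg h2 h2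
  nlinarith

theorem rnorm_nonneg (x : Matrix ι κ E) : 0 ≤ rnorm x := mnorm_nonneg _

theorem rnorm_add_le (x y : Matrix ι κ E) : rnorm (x + y) ≤ rnorm x + rnorm y := by
  unfold rnorm
  rw [pad_add]
  exact mnorm_add_le _ _

theorem rnorm_lr_le (α : Matrix ι' ι ℂ) (x : Matrix ι κ E) (β : Matrix κ κ' ℂ) :
    rnorm (lr α x β) ≤ opNorm α * rnorm x * opNorm β := by
  have key : pad (lr α x β) =
      lr ((sel (fun i => Fintype.equivFin (ι' ⊕ κ') (Sum.inl i))).conjTranspose *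
          (α * sel (fun i => Fintype.equivFin (ι ⊕ κ) (Sum.inl i)))) (pad x)
        (((sel (fun i => Fintype.equivFin (ι ⊕ κ) (Sum.inr i))).conjTranspose * β) *
          sel (fun i => Fintype.equivFin (ι' ⊕ κ') (Sum.inr i))) := by
    rw [pad_eq_lr (lr α x β), ← lr_lr, ← lr_lr, lr_sel, pad_inl_inr]
  have hx := mnorm_nonneg (pad x)
  have hα := opNorm_nonneg α
  have hβ := opNorm_nonneg β
  have h1 : opNorm ((sel (fun i => Fintype.equivFin (ι' ⊕ κ') (Sum.inl i))).conjTranspose *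
      (α * sel (fun i => Fintype.equivFin (ι ⊕ κ) (Sum.inl i)))) ≤ opNorm α :=
    (opNorm_mul _ _).trans ((mul_le_of_le_one_left (opNorm_nonneg _)
      (opNorm_selT_le injL)).trans ((opNorm_mul _ _).trans
        (mul_le_of_le_one_right hα (opNorm_sel_le injL))))
  have h2 : opNorm (((sel (fun i => Fintype.equivFin (ι ⊕ κ) (Sum.inr i))).conjTranspose * β) *
      sel (fun i => Fintype.equivFin (ι' ⊕ κ') (Sum.inr i))) ≤ opNorm β :=
    (opNorm_mul _ _).trans ((mul_le_of_le_one_right (opNorm_nonneg _)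
      (opNorm_sel_le injR)).trans ((opNorm_mul _ _).trans
        (mul_le_of_le_one_left hβ (opNorm_selT_le injR))))
  unfold rnorm
  rw [key]
  refine (mnorm_lr_le _ _ _).trans ?_
  exact mul_le_mul (mul_le_mul_of_nonneg_right h1 hx) h2 (opNorm_nonneg _) (by positivity)

theorem rnorm_lr_le_of_le_one {α : Matrix ι' ι ℂ} (x : Matrix ι κ E) {β : Matrix κ κ' ℂ}
    (hα : opNorm α ≤ 1) (hβ : opNorm β ≤ 1) : rnorm (lr α x β) ≤ rnorm x := by
  refine (rnorm_lr_le _ _ _).trans ?_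
  have hx := rnorm_nonneg x
  have h1 := opNorm_nonneg α
  have h2 := opNorm_nonneg β
  calc _ ≤ 1 * rnorm x * 1 := by gcongr
    _ = _ := by ring

theorem rnorm_eq_mnorm {n : ℕ} (x : Matrix (Fin n) (Fin n) E) : rnorm x = mnorm x := by
  have one : ∀ {a b : ℝ} {c : ℝ}, 0 ≤ a → 0 ≤ b → 0 ≤ c → a ≤ 1 → b ≤ 1 → a * c * b ≤ c := by
    intro a b c ha hb hc h1 h2
    calc _ ≤ 1 * c * 1 := by gcongr
      _ = _ := by ring
  apply le_antisymm
  · unfold rnorm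
    rw [pad_eq_lr]
    exact (mnorm_lr_le _ _ _).trans (one (opNorm_nonneg _) (opNorm_nonneg _) (mnorm_nonneg _)
      (opNorm_selT_le injL) (opNorm_sel_le injR))
  · unfold rnorm
    conv_lhs => rw [← pad_inl_inr x, ← lr_sel]
    exact (mnorm_lr_le _ _ _).trans (one (opNorm_nonneg _) (opNorm_nonneg _) (mnorm_nonneg _)
      (opNorm_sel_le injL) (opNorm_selT_le injR))

theorem rnorm_submatrix_le (x : Matrix ι κ E) {f : ι' → ι} {g : κ' → κ}
    (hf : Function.Injective f) (hg : Function.Injective g) :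
    rnorm (x.submatrix f g) ≤ rnorm x := by
  rw [← lr_sel]
  exact rnorm_lr_le_of_le_one _ (opNorm_sel_le hf) (opNorm_selT_le hg)

theorem rnorm_submatrix_equiv (x : Matrix ι κ E) (f : ι' ≃ ι) (g : κ' ≃ κ) :
    rnorm (x.submatrix f g) = rnorm x := by
  apply le_antisymm (rnorm_submatrix_le x f.injective g.injective)
  have := rnorm_submatrix_le (x.submatrix f g) f.symm.injective g.symm.injective
  simpa using this

theorem rnorm_zero : rnorm (0 : Matrix ι κ E) = 0 := by
  have : pad (0 : Matrix ι κ E) = 0 := by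
    rw [pad_eq_lr]; ext i j; simp [lr_apply]
  rw [rnorm, this, mnorm_zero]

theorem rnorm_smul_le (c : ℂ) (x : Matrix ι κ E) : rnorm (c • x) ≤ ‖c‖ * rnorm x := by
  have := rnorm_lr_le (c • (1 : Matrix ι ι ℂ)) x (1 : Matrix κ κ ℂ)
  rw [lr_smul_left, lr_one_one, opNorm_smul] at this
  refine this.trans ?_
  have hx := rnorm_nonneg x
  have h1 := opNorm_nonneg (1 : Matrix ι ι ℂ)
  have h2 := opNorm_nonneg (1 : Matrix κ κ ℂ)
  calc _ ≤ ‖c‖ * 1 * rnorm x * 1 := by gcongr <;> exact opNorm_one_le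
    _ = _ := by ring

theorem rnorm_neg (x : Matrix ι κ E) : rnorm (-x) = rnorm x := by
  have h : ∀ y : Matrix ι κ E, rnorm (-y) ≤ rnorm y := fun y => by
    simpa using rnorm_smul_le (-1) y
  exact le_antisymm (h x) (by simpa using h (-x))

theorem rnorm_fromBlocks_le (x : Matrix ι κ E) (y : Matrix ι' κ' E) :
    rnorm (Matrix.fromBlocks x 0 0 y) ≤ max (rnorm x) (rnorm y) := by
  have h : Matrix.fromBlocks x 0 0 y = (dsum (pad x) (pad y)).submatrix
      (fun i => finSumFinEquiv (Sum.map (fun i => Fintype.equivFin (ι ⊕ κ) (Sum.inl i))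
        (fun i => Fintype.equivFin (ι' ⊕ κ') (Sum.inl i)) i))
      (fun i => finSumFinEquiv (Sum.map (fun i => Fintype.equivFin (ι ⊕ κ) (Sum.inr i))
        (fun i => Fintype.equivFin (ι' ⊕ κ') (Sum.inr i)) i)) := by
    ext i j
    rcases i with i | i <;> rcases j with j | j <;>
      simp [-finSumFinEquiv_apply_left, -finSumFinEquiv_apply_right, dsum, pad]
  rw [h]
  refine (rnorm_submatrix_le _ ?_ ?_).trans ?_
  · exact finSumFinEquiv.injective.comp (Function.Injective.sumMap injL injL)
  · exact finSumFinEquiv.injective.comp (Function.Injective.sumMap injR injR)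
  · rw [rnorm_eq_mnorm, mnorm_dsum]
    rfl

theorem rnorm_fromCols_le (s t : ℝ) {x : Matrix ι κ E}
    {y : Matrix ι κ' E} (hx : rnorm x ≤ 1) (hy : rnorm y ≤ 1) :
    rnorm (Matrix.fromCols ((s : ℂ) • x) ((t : ℂ) • y)) ≤ √(s ^ 2 + t ^ 2) := by
  have h : Matrix.fromCols ((s : ℂ) • x) ((t : ℂ) • y)
      = lr (Matrix.fromCols ((s : ℂ) • (1 : Matrix ι ι ℂ)) ((t : ℂ) • (1 : Matrix ι ι ℂ)))
        (Matrix.fromBlocks x 0 0 y) 1 := by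
    ext i j
    rcases j with j | j <;>
      simp [lr_apply, Matrix.one_apply, ite_smul]
  rw [h]
  have h1 : opNorm (Matrix.fromCols ((s : ℂ) • (1 : Matrix ι ι ℂ)) ((t : ℂ) • (1 : Matrix ι ι ℂ)))
      ≤ √(s ^ 2 + t ^ 2) := by
    apply opNorm_le_of_mul_conjTranspose (Real.sqrt_nonneg _)
    rw [Matrix.conjTranspose_fromCols_eq_fromRows_conjTranspose, Matrix.fromCols_mul_fromRows,
      Real.sq_sqrt (by positivity)]
    have : (s : ℂ) • (1 : Matrix ι ι ℂ) * ((s : ℂ) • (1 : Matrix ι ι ℂ)).conjTranspose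
        + (t : ℂ) • (1 : Matrix ι ι ℂ) * ((t : ℂ) • (1 : Matrix ι ι ℂ)).conjTranspose
        = ((s ^ 2 + t ^ 2 : ℝ) : ℂ) • (1 : Matrix ι ι ℂ) := by
      rw [Complex.ofReal_add, add_smul]
      simp [Matrix.conjTranspose_smul, smul_smul, sq]
      rw [← Complex.coe_smul, ← Complex.coe_smul]
      push_cast
      rfl
    rw [this, opNorm_smul, Complex.norm_real, Real.norm_of_nonneg (by positivity)]
    exact mul_le_of_le_one_right (by positivity) opNorm_one_le
  refine (rnorm_lr_le _ _ _).trans ?_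
  have h3 : rnorm (Matrix.fromBlocks x 0 0 y) ≤ 1 :=
    (rnorm_fromBlocks_le x y).trans (max_le hx hy)
  have h4 := rnorm_nonneg (Matrix.fromBlocks x 0 0 y)
  have h5 := opNorm_nonneg (1 : Matrix (κ ⊕ κ') (κ ⊕ κ') ℂ)
  calc _ ≤ √(s ^ 2 + t ^ 2) * 1 * 1 := by gcongr; exact opNorm_one_le
    _ = _ := by ring

theorem rnorm_fromRows_le (s t : ℝ) {x : Matrix ι κ E}
    {y : Matrix ι' κ E} (hx : rnorm x ≤ 1) (hy : rnorm y ≤ 1) :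
    rnorm (Matrix.fromRows ((s : ℂ) • x) ((t : ℂ) • y)) ≤ √(s ^ 2 + t ^ 2) := by
  have h : Matrix.fromRows ((s : ℂ) • x) ((t : ℂ) • y)
      = lr 1 (Matrix.fromBlocks x 0 0 y)
        (Matrix.fromRows ((s : ℂ) • (1 : Matrix κ κ ℂ)) ((t : ℂ) • (1 : Matrix κ κ ℂ))) := by
    ext i j
    rcases i with j | j <;>
      simp [lr_apply, Matrix.one_apply, ite_smul]
  rw [h]
  have h1 : opNorm (Matrix.fromRows ((s : ℂ) • (1 : Matrix κ κ ℂ)) ((t : ℂ) • (1 : Matrix κ κ ℂ)))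
      ≤ √(s ^ 2 + t ^ 2) := by
    apply opNorm_le_of_conjTranspose_mul (Real.sqrt_nonneg _)
    rw [Matrix.conjTranspose_fromRows_eq_fromCols_conjTranspose, Matrix.fromCols_mul_fromRows,
      Real.sq_sqrt (by positivity)]
    have : ((s : ℂ) • (1 : Matrix κ κ ℂ)).conjTranspose * (s : ℂ) • (1 : Matrix κ κ ℂ)
        + ((t : ℂ) • (1 : Matrix κ κ ℂ)).conjTranspose * (t : ℂ) • (1 : Matrix κ κ ℂ)
        = ((s ^ 2 + t ^ 2 : ℝ) : ℂ) • (1 : Matrix κ κ ℂ) := by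
      rw [Complex.ofReal_add, add_smul]
      simp [Matrix.conjTranspose_smul, smul_smul, sq]
      rw [← Complex.coe_smul, ← Complex.coe_smul]
      push_cast
      rfl
    rw [this, opNorm_smul, Complex.norm_real, Real.norm_of_nonneg (by positivity)]
    exact mul_le_of_le_one_right (by positivity) opNorm_one_le
  refine (rnorm_lr_le _ _ _).trans ?_
  have h3 : rnorm (Matrix.fromBlocks x 0 0 y) ≤ 1 :=
    (rnorm_fromBlocks_le x y).trans (max_le hx hy)
  have h4 := rnorm_nonneg (Matrix.fromBlocks x 0 0 y)
  have h5 := opNorm_nonneg (1 : Matrix (ι ⊕ ι') (ι ⊕ ι') ℂ)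
  calc _ ≤ 1 * 1 * √(s ^ 2 + t ^ 2) := by
        gcongr
        · exact opNorm_nonneg _
        · exact opNorm_one_le
    _ = _ := by ring

theorem norm_entry_le (x : Matrix ι κ E) (i : ι) (j : κ) : ‖x i j‖ ≤ rnorm x := by
  have h := rnorm_submatrix_le x (f := fun _ : Fin 1 => i) (g := fun _ : Fin 1 => j)
    (Function.injective_of_subsingleton _) (Function.injective_of_subsingleton _)
  rw [rnorm_eq_mnorm, mnorm_one] at h
  exact h

theorem rnorm_single_le (i : ι) (j : κ) (v : E) : rnorm (Matrix.single i j v) ≤ ‖v‖ := by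
  have h : Matrix.single i j v = lr (sel fun _ : Fin 1 => i).conjTranspose
      (Matrix.of fun _ _ => v : Matrix (Fin 1) (Fin 1) E) (sel fun _ : Fin 1 => j) := by
    ext a b
    simp [lr_apply, sel_apply, Matrix.single_apply, Matrix.conjTranspose_apply, ite_and]
    split_ifs <;> simp
  rw [h]
  refine (rnorm_lr_le_of_le_one _ (opNorm_selT_le (Function.injective_of_subsingleton _))
    (opNorm_sel_le (Function.injective_of_subsingleton _))).trans ?_
  rw [rnorm_eq_mnorm, mnorm_one]
  rfl

theorem rnorm_sum_le {τ : Type*} (s : Finset τ) (x : τ → Matrix ι κ E) :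
    rnorm (∑ t ∈ s, x t) ≤ ∑ t ∈ s, rnorm (x t) := by
  classical
  induction s using Finset.induction_on with
  | empty => simp [rnorm_zero]
  | insert a s ha ih =>
    rw [Finset.sum_insert ha, Finset.sum_insert ha]
    exact (rnorm_add_le _ _).trans (by linarith)

theorem rnorm_le_sum (x : Matrix ι κ E) : rnorm x ≤ ∑ i, ∑ j, ‖x i j‖ := by
  conv_lhs => rw [Matrix.matrix_eq_sum_single x]
  exact (rnorm_sum_le _ _).trans (Finset.sum_le_sum fun i _ => (rnorm_sum_le _ _).trans
    (Finset.sum_le_sum fun j _ => rnorm_single_le i j _))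

theorem abs_rnorm_sub_le (x y : Matrix ι κ E) : |rnorm x - rnorm y| ≤ rnorm (x - y) := by
  rw [abs_sub_le_iff]
  constructor
  · have := rnorm_add_le (x - y) y
    rw [sub_add_cancel] at this
    linarith
  · have := rnorm_add_le (-(x - y)) x
    rw [rnorm_neg] at this
    have h : -(x - y) + x = y := by abel
    rw [h] at this
    linarith

theorem uniformContinuous_rnorm : UniformContinuous (rnorm : Matrix ι κ E → ℝ) := by
  have h : LipschitzWith (Fintype.card ι * Fintype.card κ : ℕ)
      (fun x : ι → κ → E => rnorm (Matrix.of x)) := by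
    refine LipschitzWith.of_dist_le_mul fun x y => ?_
    rw [Real.dist_eq]
    refine (abs_rnorm_sub_le _ _).trans ((rnorm_le_sum _).trans ?_)
    calc _ ≤ ∑ _i : ι, ∑ _j : κ, dist x y := by
          refine Finset.sum_le_sum fun i _ => Finset.sum_le_sum fun j _ => ?_
          have h1 := dist_le_pi_dist (x i) (y i) j
          have h2 := dist_le_pi_dist x y i
          rw [dist_eq_norm (x i j)] at h1
          exact h1.trans h2
      _ = _ := by simp [mul_assoc]
  exact h.uniformContinuous

theorem continuous_rnorm : Continuous (rnorm : Matrix ι κ E → ℝ) :=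
  uniformContinuous_rnorm.continuous

end Ruan

open MatrixNormed

section Haagerup

variable {E F : Type*} [SeminormedAddCommGroup E] [NormedSpace ℂ E]
  [SeminormedAddCommGroup F] [NormedSpace ℂ F]

/-- The matrix product `x ⊙ y` over the tensor product: `(x ⊙ y) i j = ∑ k, x i k ⊗ y k j`. -/
noncomputable def odot {E F : Type*} [AddCommGroup E] [Module ℂ E] [AddCommGroup F] [Module ℂ F]
    {ι κ ι' : Type} [Fintype κ] (x : Matrix ι κ E) (y : Matrix κ ι' F) :
    Matrix ι ι' (E ⊗[ℂ] F) :=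
  Matrix.of fun i j => ∑ k, x i k ⊗ₜ[ℂ] y k j

/-- The Haagerup matrix (semi)norms on the algebraic tensor product:
`‖u‖ₙ = inf {‖x‖ ‖y‖ : u = x ⊙ y, x ∈ M_{n,p}(E), y ∈ M_{p,n}(F), p ∈ ℕ}`. -/
noncomputable def hnorm [MatrixNormed E] [MatrixNormed F] {n : ℕ}
    (u : Matrix (Fin n) (Fin n) (E ⊗[ℂ] F)) : ℝ :=
  sInf {r : ℝ | ∃ (p : ℕ) (x : Matrix (Fin n) (Fin p) E) (y : Matrix (Fin p) (Fin n) F),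
    u = odot x y ∧ r = rnorm x * rnorm y}

variable {ι ι' ι'' κ κ' κ'' : Type} [Fintype ι] [Fintype ι'] [Fintype ι''] [Fintype κ] [Fintype κ']
  [Fintype κ''] [DecidableEq ι] [DecidableEq ι'] [DecidableEq ι''] [DecidableEq κ] [DecidableEq κ']
  [DecidableEq κ'']

theorem odot_apply {E F : Type*} [AddCommGroup E] [Module ℂ E] [AddCommGroup F] [Module ℂ F]
    {ι κ ι' : Type} [Fintype κ] (x : Matrix ι κ E) (y : Matrix κ ι' F) (i : ι) (j : ι') :
    odot x y i j = ∑ k, x i k ⊗ₜ[ℂ] y k j := rfl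

theorem lr_odot (α : Matrix ι' ι ℂ) (x : Matrix ι κ E) (y : Matrix κ κ' F) (β : Matrix κ' κ'' ℂ) :
    lr α (odot x y) β = odot (lr α x (1 : Matrix κ κ ℂ)) (lr (1 : Matrix κ κ ℂ) y β) := by
  ext i j
  simp only [odot_apply, lr_one_right, lr_one_left]
  simp only [lr_apply, odot_apply, TensorProduct.sum_tmul, TensorProduct.tmul_sum,
    TensorProduct.smul_tmul_smul, Finset.smul_sum]
  have h : ∀ a : ι, (∑ l : κ', ∑ k : κ, (α i a * β l j) • x a k ⊗ₜ[ℂ] y k l)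
      = ∑ k : κ, ∑ l : κ', (α i a * β l j) • x a k ⊗ₜ[ℂ] y k l := fun a => Finset.sum_comm
  simp only [h]
  rw [Finset.sum_comm]
  exact Finset.sum_congr rfl fun k _ => Finset.sum_comm

theorem odot_smul_smul (c d : ℂ) (x : Matrix ι κ E) (y : Matrix κ ι' F) :
    odot (c • x) (d • y) = (c * d) • odot x y := by
  ext i j
  simp only [odot_apply, Matrix.smul_apply, Finset.smul_sum, TensorProduct.smul_tmul_smul]

theorem odot_fromCols_fromRows (x : Matrix ι κ E) (x' : Matrix ι κ' E) (y : Matrix κ ι' F)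
    (y' : Matrix κ' ι' F) :
    odot (Matrix.fromCols x x') (Matrix.fromRows y y') = odot x y + odot x' y' := by
  ext i j
  simp [odot_apply]

theorem odot_fromBlocks (x : Matrix ι κ E) (x' : Matrix ι' κ' E) (y : Matrix κ ι F)
    (y' : Matrix κ' ι' F) :
    odot (Matrix.fromBlocks x 0 0 x') (Matrix.fromBlocks y 0 0 y') =
      Matrix.fromBlocks (odot x y) 0 0 (odot x' y') := by
  ext i j
  rcases i with i | i <;> rcases j with j | j <;> simp [odot_apply]

theorem odot_submatrix {ι κ ι' κ' ι'' κ'' : Type} [Fintype κ] [Fintype κ'] (x : Matrix ι κ E)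
    (y : Matrix κ ι' F) (f : ι'' → ι) (g : κ'' → ι') (e : κ' ≃ κ) : odot (x.submatrix f e) (y.submatrix e g) = (odot x y).submatrix f g := by
  ext i j
  simp only [odot_apply, Matrix.submatrix_apply]
  exact e.sum_comp fun k => x (f i) k ⊗ₜ[ℂ] y k (g j)

theorem exists_odot_of_finite (u : Matrix ι ι' (E ⊗[ℂ] F)) :
    ∃ (p : ℕ) (x : Matrix ι (Fin p) E) (y : Matrix (Fin p) ι' F), u = odot x y := by
  have add : ∀ u v : Matrix ι ι' (E ⊗[ℂ] F),
      (∃ (p : ℕ) (x : Matrix ι (Fin p) E) (y : Matrix (Fin p) ι' F), u = odot x y) →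
      (∃ (p : ℕ) (x : Matrix ι (Fin p) E) (y : Matrix (Fin p) ι' F), v = odot x y) →
      (∃ (p : ℕ) (x : Matrix ι (Fin p) E) (y : Matrix (Fin p) ι' F), u + v = odot x y) := by
    rintro _ _ ⟨p, x, y, rfl⟩ ⟨q, x', y', rfl⟩
    refine ⟨p + q, (Matrix.fromCols x x').submatrix id finSumFinEquiv.symm,
      (Matrix.fromRows y y').submatrix finSumFinEquiv.symm id, ?_⟩
    rw [odot_submatrix, odot_fromCols_fromRows, Matrix.submatrix_id_id]
  have zero : ∃ (p : ℕ) (x : Matrix ι (Fin p) E) (y : Matrix (Fin p) ι' F),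
      (0 : Matrix ι ι' (E ⊗[ℂ] F)) = odot x y :=
    ⟨0, 0, 0, by ext i j; simp [odot_apply]⟩
  induction u using Matrix.induction_on' with
  | h_zero => exact zero
  | h_add p q hp hq => exact add p q hp hq
  | h_std_basis i j v =>
    induction v using TensorProduct.induction_on with
    | zero => simpa using zero
    | add a b ha hb => rw [Matrix.single_add]; exact add _ _ ha hb
    | tmul a b =>
      refine ⟨1, Matrix.single i 0 a, Matrix.single 0 j b, ?_⟩
      ext k l
      simp only [odot_apply, Matrix.single_apply, Finset.univ_unique, Finset.sum_singleton,
        Fin.default_eq_zero, and_true, true_and]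
      by_cases h1 : i = k <;> by_cases h2 : j = l <;> simp [h1, h2]

variable [MatrixNormed E] [MatrixNormed F]

theorem hnorm_bddBelow {n : ℕ} (u : Matrix (Fin n) (Fin n) (E ⊗[ℂ] F)) :
    BddBelow {r : ℝ | ∃ (p : ℕ) (x : Matrix (Fin n) (Fin p) E) (y : Matrix (Fin p) (Fin n) F),
      u = odot x y ∧ r = rnorm x * rnorm y} := by
  refine ⟨0, ?_⟩
  rintro _ ⟨p, x, y, -, rfl⟩
  exact mul_nonneg (rnorm_nonneg _) (rnorm_nonneg _)

theorem hnorm_nonempty {n : ℕ} (u : Matrix (Fin n) (Fin n) (E ⊗[ℂ] F)) :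
    {r : ℝ | ∃ (p : ℕ) (x : Matrix (Fin n) (Fin p) E) (y : Matrix (Fin p) (Fin n) F),
      u = odot x y ∧ r = rnorm x * rnorm y}.Nonempty := by
  obtain ⟨p, x, y, h⟩ := exists_odot_of_finite u
  exact ⟨_, p, x, y, h, rfl⟩

theorem hnorm_nonneg {n : ℕ} (u : Matrix (Fin n) (Fin n) (E ⊗[ℂ] F)) : 0 ≤ hnorm u := by
  refine Real.sInf_nonneg ?_
  rintro _ ⟨p, x, y, -, rfl⟩
  exact mul_nonneg (rnorm_nonneg _) (rnorm_nonneg _)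

theorem hnorm_odot_le {n : ℕ} (x : Matrix (Fin n) κ E) (y : Matrix κ (Fin n) F) :
    hnorm (odot x y) ≤ rnorm x * rnorm y := by
  have e := Fintype.equivFin κ
  rw [← rnorm_submatrix_equiv x (Equiv.refl _) e.symm,
    ← rnorm_submatrix_equiv y e.symm (Equiv.refl _)]
  refine csInf_le (hnorm_bddBelow _) ⟨_, x.submatrix id e.symm, y.submatrix e.symm id, ?_, rfl⟩
  rw [odot_submatrix, Matrix.submatrix_id_id]

theorem exists_factor {n : ℕ} {u : Matrix (Fin n) (Fin n) (E ⊗[ℂ] F)} {s : ℝ} (hs : 0 < s)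
    (h : hnorm u < s ^ 2) : ∃ (p : ℕ) (x : Matrix (Fin n) (Fin p) E) (y : Matrix (Fin p) (Fin n) F),
      u = odot ((s : ℂ) • x) ((s : ℂ) • y) ∧ rnorm x ≤ 1 ∧ rnorm y ≤ 1 := by
  obtain ⟨_, ⟨p, x, y, rfl, rfl⟩, hr⟩ := exists_lt_of_csInf_lt (hnorm_nonempty u) h
  have ha := rnorm_nonneg x
  have hb := rnorm_nonneg y
  obtain ⟨c, hc, h1, h2⟩ : ∃ c : ℝ, 0 < c ∧ c * rnorm x ≤ s ∧ c⁻¹ * rnorm y ≤ s := by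
    rcases ha.eq_or_lt with h0 | h0
    · refine ⟨(rnorm y + 1) / s, by positivity, by rw [← h0]; simpa using hs.le, ?_⟩
      rw [inv_div, div_mul_eq_mul_div, div_le_iff₀ (by positivity)]
      nlinarith
    · refine ⟨s / rnorm x, by positivity, by field_simp; rfl, ?_⟩
      rw [inv_div, div_mul_eq_mul_div, div_le_iff₀ hs]
      nlinarith
  refine ⟨p, ((s⁻¹ * c : ℝ) : ℂ) • x, ((s⁻¹ * c⁻¹ : ℝ) : ℂ) • y, ?_, ?_, ?_⟩
  · rw [smul_smul, smul_smul, odot_smul_smul]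
    have : (s : ℂ) * ((s⁻¹ * c : ℝ) : ℂ) * ((s : ℂ) * ((s⁻¹ * c⁻¹ : ℝ) : ℂ)) = 1 := by
      have h1 : (s : ℂ) ≠ 0 := by exact_mod_cast hs.ne'
      have h2 : (c : ℂ) ≠ 0 := by exact_mod_cast hc.ne'
      push_cast
      field_simp
    rw [this, one_smul]
  · refine (rnorm_smul_le _ _).trans ?_
    rw [Complex.norm_real, Real.norm_of_nonneg (by positivity), mul_assoc, inv_mul_le_iff₀ hs,
      mul_one]
    exact h1
  · refine (rnorm_smul_le _ _).trans ?_
    rw [Complex.norm_real, Real.norm_of_nonneg (by positivity), mul_assoc, inv_mul_le_iff₀ hs,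
      mul_one]
    exact h2

theorem hnorm_add_le {n : ℕ} (u v : Matrix (Fin n) (Fin n) (E ⊗[ℂ] F)) :
    hnorm (u + v) ≤ hnorm u + hnorm v := by
  refine le_of_forall_pos_le_add fun ε hε => ?_
  have hu := hnorm_nonneg u
  have hv := hnorm_nonneg v
  have e1 : √(hnorm u + ε / 2) ^ 2 = hnorm u + ε / 2 := Real.sq_sqrt (by positivity)
  have e2 : √(hnorm v + ε / 2) ^ 2 = hnorm v + ε / 2 := Real.sq_sqrt (by positivity)
  obtain ⟨p, x, y, h1, hx, hy⟩ := exists_factor (u := u) (s := √(hnorm u + ε / 2))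
    (Real.sqrt_pos.2 (by positivity)) (by rw [e1]; linarith)
  obtain ⟨q, x', y', h2, hx', hy'⟩ := exists_factor (u := v) (s := √(hnorm v + ε / 2))
    (Real.sqrt_pos.2 (by positivity)) (by rw [e2]; linarith)
  generalize √(hnorm u + ε / 2) = s at *
  generalize √(hnorm v + ε / 2) = t at *
  have h : u + v = odot (Matrix.fromCols ((s : ℂ) • x) ((t : ℂ) • x'))
      (Matrix.fromRows ((s : ℂ) • y) ((t : ℂ) • y')) := by
    rw [odot_fromCols_fromRows, ← h1, ← h2]
  calc hnorm (u + v) ≤ rnorm (Matrix.fromCols ((s : ℂ) • x) ((t : ℂ) • x')) *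
        rnorm (Matrix.fromRows ((s : ℂ) • y) ((t : ℂ) • y')) := by
        rw [h]; exact hnorm_odot_le _ _
    _ ≤ √(s ^ 2 + t ^ 2) * √(s ^ 2 + t ^ 2) :=
        mul_le_mul (rnorm_fromCols_le s t hx hx') (rnorm_fromRows_le s t hy hy') (rnorm_nonneg _)
          (Real.sqrt_nonneg _)
    _ = s ^ 2 + t ^ 2 := Real.mul_self_sqrt (by positivity)
    _ = _ := by rw [e1, e2]; ring

theorem hnorm_lr_le {m n : ℕ} (α : Matrix (Fin n) (Fin m) ℂ)
    (u : Matrix (Fin m) (Fin m) (E ⊗[ℂ] F)) (β : Matrix (Fin m) (Fin n) ℂ) :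
    hnorm (lr α u β) ≤ opNorm α * hnorm u * opNorm β := by
  have hα := opNorm_nonneg α
  have hβ := opNorm_nonneg β
  have h : opNorm α * hnorm u * opNorm β = (opNorm α * opNorm β) • hnorm u := by
    rw [smul_eq_mul]; ring
  rw [h, hnorm, hnorm, ← Real.sInf_smul_of_nonneg (by positivity)]
  refine le_csInf (Set.Nonempty.smul_set (hnorm_nonempty u)) ?_
  rintro _ ⟨_, ⟨p, x, y, rfl, rfl⟩, rfl⟩
  refine (csInf_le (hnorm_bddBelow _) ⟨p, lr α x 1, lr 1 y β, lr_odot _ _ _ _, rfl⟩).trans ?_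
  have hx := rnorm_nonneg x
  have hy := rnorm_nonneg y
  have h1 : rnorm (lr α x (1 : Matrix (Fin p) (Fin p) ℂ)) ≤ opNorm α * rnorm x :=
    (rnorm_lr_le _ _ _).trans (mul_le_of_le_one_right (by positivity) opNorm_one_le)
  have h2 : rnorm (lr (1 : Matrix (Fin p) (Fin p) ℂ) y β) ≤ rnorm y * opNorm β := by
    refine (rnorm_lr_le _ _ _).trans ?_
    rw [mul_assoc]
    exact mul_le_of_le_one_left (by positivity) opNorm_one_le
  refine (mul_le_mul h1 h2 (rnorm_nonneg _) (by positivity)).trans (le_of_eq ?_)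
  simp only [smul_eq_mul]
  ring

theorem hnorm_submatrix_le {m n : ℕ} (u : Matrix (Fin m) (Fin m) (E ⊗[ℂ] F))
    {f g : Fin n → Fin m} (hf : Function.Injective f) (hg : Function.Injective g) :
    hnorm (u.submatrix f g) ≤ hnorm u := by
  have h : u.submatrix f g = lr (sel f) u (sel g).conjTranspose := (lr_sel f g u).symm
  rw [h]
  refine (hnorm_lr_le _ _ _).trans ?_
  have hu := hnorm_nonneg u
  have h1 := opNorm_sel_le hf
  have h2 := opNorm_selT_le hg
  have h3 := opNorm_nonneg (sel f)
  calc _ ≤ 1 * hnorm u * 1 :=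
        mul_le_mul (mul_le_mul_of_nonneg_right h1 hu) h2 (opNorm_nonneg _) (by positivity)
    _ = _ := by ring

theorem hnorm_dsum {m n : ℕ} (u : Matrix (Fin m) (Fin m) (E ⊗[ℂ] F))
    (v : Matrix (Fin n) (Fin n) (E ⊗[ℂ] F)) : hnorm (dsum u v) = max (hnorm u) (hnorm v) := by
  apply le_antisymm
  · refine le_of_forall_pos_le_add fun ε hε => ?_
    have hu := hnorm_nonneg u
    have hm : 0 ≤ max (hnorm u) (hnorm v) := hu.trans (le_max_left _ _)
    have e1 : √(max (hnorm u) (hnorm v) + ε) ^ 2 = max (hnorm u) (hnorm v) + ε :=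
      Real.sq_sqrt (by positivity)
    have hs : 0 < √(max (hnorm u) (hnorm v) + ε) := Real.sqrt_pos.2 (by positivity)
    obtain ⟨p, x, y, h1, hx, hy⟩ := exists_factor (u := u) hs
      (by rw [e1]; linarith [le_max_left (hnorm u) (hnorm v)])
    obtain ⟨q, x', y', h2, hx', hy'⟩ := exists_factor (u := v) hs
      (by rw [e1]; linarith [le_max_right (hnorm u) (hnorm v)])
    rw [← e1]
    generalize √(max (hnorm u) (hnorm v) + ε) = s at *
    have h : dsum u v = odot (((s : ℂ) • Matrix.fromBlocks x 0 0 x').submatrix finSumFinEquiv.symm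
        (Equiv.refl _)) (((s : ℂ) • Matrix.fromBlocks y 0 0 y').submatrix (Equiv.refl _)
          finSumFinEquiv.symm) := by
      rw [odot_submatrix, odot_smul_smul, odot_fromBlocks, h1, h2, odot_smul_smul, odot_smul_smul,
        dsum, Matrix.fromBlocks_smul, smul_zero, smul_zero]
    rw [h]
    refine (hnorm_odot_le _ _).trans ?_
    rw [rnorm_submatrix_equiv, rnorm_submatrix_equiv, sq]
    refine mul_le_mul ?_ ?_ (rnorm_nonneg _) hs.le
    · refine (rnorm_smul_le _ _).trans ?_
      rw [Complex.norm_real, Real.norm_of_nonneg hs.le]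
      exact mul_le_of_le_one_right hs.le ((rnorm_fromBlocks_le _ _).trans (max_le hx hx'))
    · refine (rnorm_smul_le _ _).trans ?_
      rw [Complex.norm_real, Real.norm_of_nonneg hs.le]
      exact mul_le_of_le_one_right hs.le ((rnorm_fromBlocks_le _ _).trans (max_le hy hy'))
  · apply max_le
    · have h : u = (dsum u v).submatrix (fun i => finSumFinEquiv (Sum.inl i))
          (fun i => finSumFinEquiv (Sum.inl i)) := by
        ext i j; simp [-finSumFinEquiv_apply_left, dsum]
      conv_lhs => rw [h]
      exact hnorm_submatrix_le _ (finSumFinEquiv.injective.comp Sum.inl_injective)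
        (finSumFinEquiv.injective.comp Sum.inl_injective)
    · have h : v = (dsum u v).submatrix (fun i => finSumFinEquiv (Sum.inr i))
          (fun i => finSumFinEquiv (Sum.inr i)) := by
        ext i j; simp [-finSumFinEquiv_apply_right, dsum]
      conv_lhs => rw [h]
      exact hnorm_submatrix_le _ (finSumFinEquiv.injective.comp Sum.inr_injective)
        (finSumFinEquiv.injective.comp Sum.inr_injective)

theorem hnorm_smul_le {n : ℕ} (c : ℂ) (u : Matrix (Fin n) (Fin n) (E ⊗[ℂ] F)) :
    hnorm (c • u) ≤ ‖c‖ * hnorm u := by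
  have h : c • u = lr (c • (1 : Matrix (Fin n) (Fin n) ℂ)) u 1 := by
    rw [lr_smul_left, lr_one_one]
  rw [h]
  refine (hnorm_lr_le _ _ _).trans ?_
  rw [opNorm_smul]
  have hu := hnorm_nonneg u
  have h1 := opNorm_nonneg (1 : Matrix (Fin n) (Fin n) ℂ)
  calc _ ≤ ‖c‖ * 1 * hnorm u * 1 := by gcongr <;> exact opNorm_one_le
    _ = _ := by ring

theorem hnorm_smul {n : ℕ} (c : ℂ) (u : Matrix (Fin n) (Fin n) (E ⊗[ℂ] F)) :
    hnorm (c • u) = ‖c‖ * hnorm u := by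
  rcases eq_or_ne c 0 with rfl | hc
  · apply le_antisymm (hnorm_smul_le _ _)
    simpa using hnorm_nonneg _
  apply le_antisymm (hnorm_smul_le _ _)
  have h := hnorm_smul_le c⁻¹ (c • u)
  rw [smul_smul, inv_mul_cancel₀ hc, one_smul, norm_inv] at h
  have : 0 < ‖c‖ := norm_pos_iff.2 hc
  rwa [le_inv_mul_iff₀ this] at h

end Haagerup

section HTensor

/-- The algebraic tensor product `E ⊗ F`, considered with the Haagerup matrix norms. -/
def HTensor (E F : Type*) [SeminormedAddCommGroup E] [NormedSpace ℂ E]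
    [SeminormedAddCommGroup F] [NormedSpace ℂ F] : Type _ := E ⊗[ℂ] F

variable (E F : Type*) [SeminormedAddCommGroup E] [NormedSpace ℂ E]
  [SeminormedAddCommGroup F] [NormedSpace ℂ F] [MatrixNormed E] [MatrixNormed F]

noncomputable instance : AddCommGroup (HTensor E F) := inferInstanceAs (AddCommGroup (E ⊗[ℂ] F))

noncomputable instance : Module ℂ (HTensor E F) := inferInstanceAs (Module ℂ (E ⊗[ℂ] F))

noncomputable instance : Norm (HTensor E F) where
  norm u := hnorm (Matrix.of fun _ _ : Fin 1 => (u : E ⊗[ℂ] F))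

theorem HTensor.core : SeminormedSpace.Core ℂ (HTensor E F) where
  norm_nonneg _ := hnorm_nonneg (E := E) (F := F) _
  norm_smul c _ := hnorm_smul (E := E) (F := F) c _
  norm_triangle _ _ := hnorm_add_le (E := E) (F := F) _ _

noncomputable instance : SeminormedAddCommGroup (HTensor E F) :=
  SeminormedAddCommGroup.ofCore (HTensor.core E F)

noncomputable instance : NormedSpace ℂ (HTensor E F) where
  norm_smul_le c _ := (hnorm_smul (E := E) (F := F) c _).le

noncomputable instance : MatrixNormed (HTensor E F) where
  mnorm u := hnorm (E := E) (F := F) u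
  mnorm_one x := by
    change hnorm (E := E) (F := F) x = hnorm (E := E) (F := F) (Matrix.of fun _ _ => x 0 0)
    congr 1
    ext i j
    rw [Subsingleton.elim i 0, Subsingleton.elim j 0]
    rfl
  mnorm_add_le x y := hnorm_add_le (E := E) (F := F) x y
  mnorm_lr_le α x β := hnorm_lr_le (E := E) (F := F) α x β
  mnorm_dsum x y := hnorm_dsum (E := E) (F := F) x y

variable {E F}

/-- `x ⊙ y` as a matrix over `E ⊗ F` with the Haagerup matrix norms. -/
noncomputable def hodot {ι κ ι' : Type} [Fintype κ] (x : Matrix ι κ E) (y : Matrix κ ι' F) :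
    Matrix ι ι' (HTensor E F) := odot x y

theorem mnorm_hodot_le {n : ℕ} {κ : Type} [Fintype κ] [DecidableEq κ] (x : Matrix (Fin n) κ E)
    (y : Matrix κ (Fin n) F) : mnorm (hodot x y) ≤ rnorm x * rnorm y :=
  hnorm_odot_le x y

theorem exists_hfactor {n : ℕ} {u : Matrix (Fin n) (Fin n) (HTensor E F)} {s : ℝ} (hs : 0 < s)
    (h : mnorm u < s ^ 2) : ∃ (p : ℕ) (x : Matrix (Fin n) (Fin p) E) (y : Matrix (Fin p) (Fin n) F),
      u = hodot ((s : ℂ) • x) ((s : ℂ) • y) ∧ rnorm x ≤ 1 ∧ rnorm y ≤ 1 :=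
  exists_factor (E := E) (F := F) hs h

theorem hodot_submatrix {ι κ ι' κ' ι'' κ'' : Type} [Fintype κ] [Fintype κ'] (x : Matrix ι κ E)
    (y : Matrix κ ι' F) (f : ι'' → ι) (g : κ'' → ι') (e : κ' ≃ κ) :
    hodot (x.submatrix f e) (y.submatrix e g) = (hodot x y).submatrix f g :=
  odot_submatrix x y f g e

end HTensor

section Completion

open UniformSpace

variable {V : Type*} [SeminormedAddCommGroup V] [NormedSpace ℂ V]
variable {ι κ : Type} [Fintype ι] [Fintype κ] [DecidableEq ι] [DecidableEq κ]

/-- The entrywise inclusion of matrices over `V` into matrices over the completion of `V`. -/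
def cmap {ι κ : Type} {V : Type*} [SeminormedAddCommGroup V] (x : Matrix ι κ V) :
    Matrix ι κ (Completion V) :=
  x.map fun v => (v : Completion V)

theorem cmap_isUniformInducing : IsUniformInducing (cmap : Matrix ι κ V → _) := by
  constructor
  rw [Matrix.uniformity, Matrix.uniformity, Filter.comap_iInf]
  refine iInf_congr fun i => ?_
  rw [Filter.comap_iInf]
  refine iInf_congr fun j => ?_
  rw [Filter.comap_comap, ← (Completion.isUniformInducing_coe V).comap_uniformity,
    Filter.comap_comap]
  rfl

theorem cmap_denseRange : DenseRange (cmap : Matrix ι κ V → _) := by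
  have h : DenseRange (Pi.map fun _ : ι => Pi.map fun _ : κ => ((↑) : V → Completion V)) :=
    DenseRange.piMap fun _ => DenseRange.piMap fun _ => Completion.denseRange_coe
  exact h

theorem cmap_isDenseInducing : IsDenseInducing (cmap : Matrix ι κ V → _) :=
  cmap_isUniformInducing.isDenseInducing cmap_denseRange

theorem cmap_add (x y : Matrix ι κ V) : cmap (x + y) = cmap x + cmap y := by
  ext i j
  exact UniformSpace.Completion.coe_add _ _

theorem cmap_lr {ι' κ' : Type} [Fintype κ'] [Fintype ι'] [DecidableEq κ'] [DecidableEq ι'] (α : Matrix ι' ι ℂ) (x : Matrix ι κ V) (β : Matrix κ κ' ℂ) :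
    cmap (lr α x β) = lr α (cmap x) β :=
  lr_map (Completion.toComplL (𝕜 := ℂ) (E := V) : V →ₗ[ℂ] Completion V) α x β

theorem cmap_dsum {m n : ℕ} (x : Matrix (Fin m) (Fin m) V) (y : Matrix (Fin n) (Fin n) V) :
    cmap (dsum x y) = dsum (cmap x) (cmap y) := by
  ext i j
  obtain ⟨i, rfl⟩ := finSumFinEquiv.surjective i
  obtain ⟨j, rfl⟩ := finSumFinEquiv.surjective j
  rcases i with i | i <;> rcases j with j | j <;>
    simp [cmap, dsum, -finSumFinEquiv_apply_left, -finSumFinEquiv_apply_right] <;> rfl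

theorem continuous_lr {ι' κ' : Type} [Fintype κ'] [Fintype ι'] [DecidableEq κ'] [DecidableEq ι']
    (α : Matrix ι' ι ℂ) (β : Matrix κ κ' ℂ) :
    Continuous fun x : Matrix ι κ V => lr α x β := by
  refine continuous_matrix fun i j => ?_
  simp only [lr_apply]
  fun_prop

theorem continuous_dsum {m n : ℕ} :
    Continuous fun p : Matrix (Fin m) (Fin m) V × Matrix (Fin n) (Fin n) V => dsum p.1 p.2 :=
  Continuous.matrix_submatrix (Continuous.matrix_fromBlocks continuous_fst continuous_const
    continuous_const continuous_snd) _ _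

variable [MatrixNormed V]

theorem uniformContinuous_mnorm {n : ℕ} :
    UniformContinuous (mnorm : Matrix (Fin n) (Fin n) V → ℝ) := by
  have h : (mnorm : Matrix (Fin n) (Fin n) V → ℝ) = rnorm := by
    funext x
    exact (rnorm_eq_mnorm x).symm
  rw [h]
  exact uniformContinuous_rnorm

/-- The continuous extension of `‖·‖ₙ` from `M_n(V)` to `M_n` of the completion of `V`. -/
noncomputable def cnorm {n : ℕ} (ξ : Matrix (Fin n) (Fin n) (Completion V)) : ℝ :=
  (cmap_isDenseInducing (V := V)).extend mnorm ξ

theorem continuous_cnorm {n : ℕ} :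
    Continuous (cnorm : Matrix (Fin n) (Fin n) (Completion V) → ℝ) :=
  (uniformContinuous_uniformly_extend cmap_isUniformInducing cmap_denseRange
    uniformContinuous_mnorm).continuous

theorem cnorm_cmap {n : ℕ} (x : Matrix (Fin n) (Fin n) V) : cnorm (cmap x) = mnorm x :=
  IsDenseInducing.extend_eq _ uniformContinuous_mnorm.continuous x

noncomputable instance : MatrixNormed (Completion V) where
  mnorm ξ := cnorm ξ
  mnorm_one ξ := by
    refine cmap_denseRange.induction_on (p := fun ξ => cnorm ξ = ‖ξ 0 0‖) ξ
      (isClosed_eq continuous_cnorm (by fun_prop)) fun x => ?_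
    rw [cnorm_cmap, mnorm_one, cmap, Matrix.map_apply, Completion.norm_coe]
  mnorm_add_le ξ η := by
    refine cmap_denseRange.induction_on₂ (p := fun ξ η => cnorm (ξ + η) ≤ cnorm ξ + cnorm η)
      (isClosed_le (continuous_cnorm.comp continuous_add)
        ((continuous_cnorm.comp continuous_fst).add (continuous_cnorm.comp continuous_snd)))
      (fun x y => ?_) ξ η
    rw [← cmap_add, cnorm_cmap, cnorm_cmap, cnorm_cmap]
    exact mnorm_add_le x y
  mnorm_lr_le α ξ β := by
    refine cmap_denseRange.induction_on
      (p := fun ξ => cnorm (lr α ξ β) ≤ opNorm α * cnorm ξ * opNorm β) ξ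
      (isClosed_le (continuous_cnorm.comp (continuous_lr α β))
        ((continuous_const.mul continuous_cnorm).mul continuous_const)) fun x => ?_
    rw [← cmap_lr, cnorm_cmap, cnorm_cmap]
    exact mnorm_lr_le α x β
  mnorm_dsum {m n} ξ η := by
    have h : ∀ p : Matrix (Fin m) (Fin m) (Completion V) × Matrix (Fin n) (Fin n) (Completion V),
        cnorm (dsum p.1 p.2) = max (cnorm p.1) (cnorm p.2) := by
      intro p
      refine (cmap_denseRange.prodMap cmap_denseRange).induction_on
        (p := fun p => cnorm (dsum p.1 p.2) = max (cnorm p.1) (cnorm p.2)) p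
        (isClosed_eq (continuous_cnorm.comp continuous_dsum)
          ((continuous_cnorm.comp continuous_fst).max (continuous_cnorm.comp continuous_snd)))
        fun q => ?_
      simp only [Prod.map_fst, Prod.map_snd]
      rw [← cmap_dsum, cnorm_cmap, cnorm_cmap, cnorm_cmap]
      exact mnorm_dsum q.1 q.2
    exact h (ξ, η)

theorem mnorm_cmap {n : ℕ} (x : Matrix (Fin n) (Fin n) V) : mnorm (cmap x) = mnorm x :=
  cnorm_cmap x

theorem rnorm_cmap (x : Matrix ι κ V) : rnorm (cmap x) = rnorm x := by
  unfold rnorm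
  rw [pad_eq_lr, ← cmap_lr, ← pad_eq_lr, mnorm_cmap]

end Completion

section Algebras

open MulOpposite

/-- A unital operator algebra: a unital Banach algebra `A` that is also an operator space, with
`‖1‖ ≤ 1`, such that the map `A ⊗ A → A` given by the multiplication is completely contractive
for the Haagerup matrix norms. -/
class OperatorAlgebra (A : Type*) [NormedRing A] [NormedAlgebra ℂ A] [MatrixNormed A] : Prop where
  norm_one_le : ‖(1 : A)‖ ≤ 1
  mnorm_mul_le : ∀ {n : ℕ} (u : Matrix (Fin n) (Fin n) (A ⊗[ℂ] A)),
    mnorm (u.map (LinearMap.mul' ℂ A)) ≤ hnorm u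

/-- The linear map `E ⊗ A → E`, `x ⊗ a ↦ x · a`, given by the action on a right `A`-module. -/
noncomputable def actionMap (A E : Type*) [Ring A] [Algebra ℂ A] [AddCommGroup E] [Module ℂ E]
    [Module Aᵐᵒᵖ E] [IsScalarTower ℂ Aᵐᵒᵖ E] : E ⊗[ℂ] A →ₗ[ℂ] E :=
  TensorProduct.lift (LinearMap.mk₂ ℂ (fun (x : E) (a : A) => op a • x)
    (fun x y a => smul_add _ _ _)
    (fun c x a => by
      rw [← algebraMap_smul Aᵐᵒᵖ c x, ← algebraMap_smul Aᵐᵒᵖ c (op a • x), smul_smul, smul_smul,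
        Algebra.commutes])
    (fun x a b => by rw [op_add, add_smul])
    (fun c x a => by rw [op_smul, smul_assoc]))

/-- A right `A`-module `E` that is an operator space is a right operator `A`-module if the map
`E ⊗ A → E` given by the module action is completely contractive for the Haagerup matrix
norms. -/
class OperatorModule (A E : Type*) [NormedRing A] [NormedAlgebra ℂ A] [MatrixNormed A]
    [SeminormedAddCommGroup E] [NormedSpace ℂ E] [MatrixNormed E]
    [Module Aᵐᵒᵖ E] [IsScalarTower ℂ Aᵐᵒᵖ E] : Prop where
  mnorm_action_le : ∀ {n : ℕ} (u : Matrix (Fin n) (Fin n) (E ⊗[ℂ] A)),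
    mnorm (u.map (actionMap A E)) ≤ hnorm u

variable {ι ι' κ κ' : Type} [Fintype ι] [Fintype ι'] [Fintype κ] [Fintype κ']
  [DecidableEq ι] [DecidableEq ι'] [DecidableEq κ] [DecidableEq κ']

theorem rnorm_map_odot_le {E F G : Type*} [SeminormedAddCommGroup E] [NormedSpace ℂ E]
    [SeminormedAddCommGroup F] [NormedSpace ℂ F] [SeminormedAddCommGroup G] [NormedSpace ℂ G]
    [MatrixNormed E] [MatrixNormed F] [MatrixNormed G] (f : E ⊗[ℂ] F →ₗ[ℂ] G)
    (hf : ∀ {n : ℕ} (u : Matrix (Fin n) (Fin n) (E ⊗[ℂ] F)), mnorm (u.map f) ≤ hnorm u)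
    (x : Matrix ι κ E) (y : Matrix κ ι' F) :
    rnorm ((odot x y).map f) ≤ rnorm x * rnorm y := by
  unfold rnorm
  rw [pad_eq_lr, ← lr_map, lr_odot]
  refine (hf _).trans ((hnorm_odot_le _ _).trans ?_)
  exact mul_le_mul (rnorm_lr_le_of_le_one _ (opNorm_selT_le injL) opNorm_one_le)
    (rnorm_lr_le_of_le_one _ opNorm_one_le (opNorm_sel_le injR)) (rnorm_nonneg _) (rnorm_nonneg _)

variable {E A : Type*} [SeminormedAddCommGroup E] [NormedSpace ℂ E] [MatrixNormed E]
  [NormedRing A] [NormedAlgebra ℂ A] [MatrixNormed A]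

theorem rnorm_mul_le [OperatorAlgebra A] (x : Matrix ι κ A) (y : Matrix κ ι' A) :
    rnorm (x * y) ≤ rnorm x * rnorm y := by
  have h : x * y = (odot x y).map (LinearMap.mul' ℂ A) := by
    ext i j
    simp [odot_apply, Matrix.mul_apply]
  rw [h]
  exact rnorm_map_odot_le _ OperatorAlgebra.mnorm_mul_le x y

/-- The right `A`-module structure of `E ⊗ A`, given by `(x ⊗ a) · b = x ⊗ ab`. -/
noncomputable instance : Module Aᵐᵒᵖ (HTensor E A) where
  smul b u := LinearMap.lTensor E (LinearMap.mulRight ℂ b.unop) (u : E ⊗[ℂ] A)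
  one_smul u := by
    have h : LinearMap.lTensor E (LinearMap.mulRight ℂ (1 : A)) = LinearMap.id := by
      rw [LinearMap.mulRight_one, LinearMap.lTensor_id]
    exact DFunLike.congr_fun h u
  mul_smul b c u := by
    have h : LinearMap.lTensor E (LinearMap.mulRight ℂ (c.unop * b.unop)) =
        (LinearMap.lTensor E (LinearMap.mulRight ℂ b.unop)).comp
          (LinearMap.lTensor E (LinearMap.mulRight ℂ c.unop)) := by
      rw [LinearMap.mulRight_mul, LinearMap.lTensor_comp]
    exact DFunLike.congr_fun h u
  smul_zero b := map_zero (LinearMap.lTensor E (LinearMap.mulRight ℂ b.unop))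
  smul_add b := map_add (LinearMap.lTensor E (LinearMap.mulRight ℂ b.unop))
  add_smul b c u := by
    have h : LinearMap.lTensor E (LinearMap.mulRight ℂ (b.unop + c.unop)) =
        LinearMap.lTensor E (LinearMap.mulRight ℂ b.unop) +
          LinearMap.lTensor E (LinearMap.mulRight ℂ c.unop) := by
      rw [← LinearMap.lTensor_add]
      congr 1
      ext
      simp [mul_add]
    exact DFunLike.congr_fun h u
  zero_smul u := by
    have h : LinearMap.lTensor E (LinearMap.mulRight ℂ (0 : A)) = 0 := by
      rw [LinearMap.mulRight_zero_eq_zero, LinearMap.lTensor_zero]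
    exact DFunLike.congr_fun h u

/-- The elementary tensor `x ⊗ a`. -/
noncomputable def HTensor.tmul (x : E) (a : A) : HTensor E A := x ⊗ₜ[ℂ] a

theorem HTensor.op_smul_tmul (x : E) (a b : A) :
    op b • HTensor.tmul x a = HTensor.tmul x (a * b) := rfl

theorem HTensor.op_smul_def (b : A) (u : HTensor E A) :
    op b • u = LinearMap.lTensor E (LinearMap.mulRight ℂ b) (u : E ⊗[ℂ] A) := rfl

instance : IsScalarTower ℂ Aᵐᵒᵖ (HTensor E A) where
  smul_assoc c b u := by
    have h : LinearMap.lTensor E (LinearMap.mulRight ℂ (c • b.unop)) =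
        c • LinearMap.lTensor E (LinearMap.mulRight ℂ b.unop) := by
      rw [← LinearMap.lTensor_smul]
      congr 1
      ext
      simp
    exact DFunLike.congr_fun h u

theorem actionMap_tmul {M : Type*} [AddCommGroup M] [Module ℂ M] [Module Aᵐᵒᵖ M]
    [IsScalarTower ℂ Aᵐᵒᵖ M] (x : M) (a : A) : actionMap A M (x ⊗ₜ[ℂ] a) = op a • x := rfl

theorem map_actionMap_odot {M : Type*} [AddCommGroup M] [Module ℂ M] [Module Aᵐᵒᵖ M]
    [IsScalarTower ℂ Aᵐᵒᵖ M] (x : Matrix ι κ M) (b : Matrix κ ι' A) (i : ι) (j : ι') :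
    (odot x b).map (actionMap A M) i j = ∑ k, op (b k j) • x i k := by
  rw [Matrix.map_apply, odot_apply, map_sum]
  rfl

theorem actionMap_odot_hodot (x : Matrix ι κ E) (y : Matrix κ κ' A) (b : Matrix κ' ι' A) :
    (odot (hodot x y) b).map (actionMap A (HTensor E A)) = hodot x (y * b) := by
  ext i j
  rw [map_actionMap_odot]
  have h1 : ∀ k, op (b k j) • hodot x y i k =
      (∑ l, x i l ⊗ₜ[ℂ] (y l k * b k j) : E ⊗[ℂ] A) := fun k => by
    have h : LinearMap.lTensor E (LinearMap.mulRight ℂ (b k j))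
      (∑ l, x i l ⊗ₜ[ℂ] y l k : E ⊗[ℂ] A) = ∑ l, x i l ⊗ₜ[ℂ] (y l k * b k j) := by
      simp [map_sum]
    exact h
  have h2 : (∑ k, ∑ l, x i l ⊗ₜ[ℂ] (y l k * b k j) : E ⊗[ℂ] A) = odot x (y * b) i j := by
    simp only [odot_apply, Matrix.mul_apply, TensorProduct.tmul_sum]
    exact Finset.sum_comm
  exact (Finset.sum_congr rfl fun k _ => h1 k).trans h2

theorem mnorm_action_HTensor_le [OperatorAlgebra A] {n p : ℕ}
    (U : Matrix (Fin n) (Fin p) (HTensor E A)) (b : Matrix (Fin p) (Fin n) A) :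
    mnorm ((odot U b).map (actionMap A (HTensor E A))) ≤ rnorm U * rnorm b := by
  have hU := rnorm_nonneg U
  have hb := rnorm_nonneg b
  have key : ∀ δ : ℝ, 0 < δ →
      mnorm ((odot U b).map (actionMap A (HTensor E A))) ≤ (rnorm U + δ) * rnorm b := by
    intro δ hδ
    have e1 : √(rnorm U + δ) ^ 2 = rnorm U + δ := Real.sq_sqrt (by positivity)
    have hs : 0 < √(rnorm U + δ) := Real.sqrt_pos.2 (by positivity)
    obtain ⟨q, x, y, h, hx, hy⟩ := exists_hfactor (u := pad U) hs
      (by rw [e1]; change rnorm U < _; linarith)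
    rw [← e1]
    generalize √(rnorm U + δ) = s at *
    have hU' := pad_inl_inr U
    rw [h] at hU'
    have hU2 : U = hodot (((s : ℂ) • x).submatrix
        (fun i => Fintype.equivFin (Fin n ⊕ Fin p) (Sum.inl i)) (Equiv.refl _))
        (((s : ℂ) • y).submatrix (Equiv.refl _)
          (fun i => Fintype.equivFin (Fin n ⊕ Fin p) (Sum.inr i))) := by
      rw [hodot_submatrix]
      exact hU'.symm
    have hsx : rnorm ((s : ℂ) • x) ≤ s := by
      refine (rnorm_smul_le _ _).trans ?_
      rw [Complex.norm_real, Real.norm_of_nonneg hs.le]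
      exact mul_le_of_le_one_right hs.le hx
    have hsy : rnorm ((s : ℂ) • y) ≤ s := by
      refine (rnorm_smul_le _ _).trans ?_
      rw [Complex.norm_real, Real.norm_of_nonneg hs.le]
      exact mul_le_of_le_one_right hs.le hy
    conv_lhs => rw [hU2, actionMap_odot_hodot]
    refine (mnorm_hodot_le _ _).trans ?_
    refine (mul_le_mul ((rnorm_submatrix_le _ injL (Equiv.injective _)).trans hsx)
      ((rnorm_mul_le _ _).trans (mul_le_mul_of_nonneg_right
        ((rnorm_submatrix_le _ (Equiv.injective _) injR).trans hsy) hb))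
      (rnorm_nonneg _) hs.le).trans (le_of_eq (by ring))
  refine le_of_forall_pos_le_add fun ε hε => ?_
  refine (key (ε / (rnorm b + 1)) (by positivity)).trans ?_
  have : ε / (rnorm b + 1) * rnorm b ≤ ε := by
    rw [div_mul_eq_mul_div, div_le_iff₀ (by positivity)]
    nlinarith
  linarith

theorem norm_op_smul_HTensor_le [OperatorAlgebra A] (u : HTensor E A) (b : A) :
    ‖op b • u‖ ≤ ‖b‖ * ‖u‖ := by
  have h := mnorm_action_HTensor_le (Matrix.of fun _ _ : Fin 1 => u) (Matrix.of fun _ _ : Fin 1 => b)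
  rw [mnorm_one, rnorm_eq_mnorm, rnorm_eq_mnorm, mnorm_one, mnorm_one, map_actionMap_odot] at h
  simpa [mul_comm] using h

instance [OperatorAlgebra A] : UniformContinuousConstSMul Aᵐᵒᵖ (HTensor E A) where
  uniformContinuous_const_smul b := by
    have h : LipschitzWith ‖b.unop‖₊ (fun u : HTensor E A => b • u) := by
      refine LipschitzWith.of_dist_le_mul fun u v => ?_
      rw [dist_eq_norm, dist_eq_norm, ← smul_sub]
      exact norm_op_smul_HTensor_le _ _
    exact h.uniformContinuous

/-- The Haagerup tensor product `E ⊗_h A` of operator spaces: the completion of the algebraic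
tensor product with the Haagerup matrix norms. -/
abbrev Haagerup (E F : Type*) [SeminormedAddCommGroup E] [NormedSpace ℂ E] [MatrixNormed E]
    [SeminormedAddCommGroup F] [NormedSpace ℂ F] [MatrixNormed F] : Type _ :=
  UniformSpace.Completion (HTensor E F)

/-- The elementary tensor `x ⊗ a` in `E ⊗_h A`. -/
noncomputable def Haagerup.tmul (x : E) (a : A) : Haagerup E A :=
  (HTensor.tmul x a : UniformSpace.Completion (HTensor E A))

theorem Haagerup.op_smul_tmul [OperatorAlgebra A] (x : E) (a b : A) :
    op b • (Haagerup.tmul x a : Haagerup E A) = Haagerup.tmul x (a * b) :=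
  (UniformSpace.Completion.coe_smul (op b) (HTensor.tmul x a)).symm

theorem map_actionMap_cmap [OperatorAlgebra A] (x : Matrix ι κ (HTensor E A))
    (b : Matrix κ ι' A) : (odot (cmap x) b).map (actionMap A (Haagerup E A)) =
      cmap ((odot x b).map (actionMap A (HTensor E A))) := by
  ext i j
  have e : cmap ((odot x b).map (actionMap A (HTensor E A))) i j =
    (((odot x b).map (actionMap A (HTensor E A)) i j : HTensor E A) : Haagerup E A) := rfl
  rw [map_actionMap_odot, e, map_actionMap_odot]
  have h := map_sum (UniformSpace.Completion.toComplL (𝕜 := ℂ) (E := HTensor E A))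
    (fun k => op (b k j) • x i k) Finset.univ
  refine Eq.trans ?_ h.symm
  exact Finset.sum_congr rfl fun k _ => (UniformSpace.Completion.coe_smul _ _).symm

theorem continuous_map_actionMap [OperatorAlgebra A] (b : Matrix κ ι' A) :
    Continuous fun X : Matrix ι κ (Haagerup E A) =>
      (odot X b).map (actionMap A (Haagerup E A)) := by
  refine continuous_matrix fun i j => ?_
  simp only [map_actionMap_odot]
  exact continuous_finsetSum _ fun k _ =>
    (continuous_const_smul _).comp (continuous_id.matrix_elem i k)

theorem mnorm_action_Haagerup_le [OperatorAlgebra A] {n p : ℕ}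
    (X : Matrix (Fin n) (Fin p) (Haagerup E A)) (b : Matrix (Fin p) (Fin n) A) :
    mnorm ((odot X b).map (actionMap A (Haagerup E A))) ≤ rnorm X * rnorm b := by
  refine cmap_denseRange.induction_on
    (p := fun X : Matrix (Fin n) (Fin p) (Haagerup E A) =>
      mnorm ((odot X b).map (actionMap A (Haagerup E A))) ≤ rnorm X * rnorm b) X
    (isClosed_le (uniformContinuous_mnorm.continuous.comp (continuous_map_actionMap b))
      (continuous_rnorm.mul continuous_const)) fun x => ?_
  rw [map_actionMap_cmap, mnorm_cmap, rnorm_cmap]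
  exact mnorm_action_HTensor_le x b

instance [OperatorAlgebra A] : OperatorModule A (Haagerup E A) where
  mnorm_action_le u := by
    refine le_csInf (hnorm_nonempty u) ?_
    rintro _ ⟨p, X, b, rfl, rfl⟩
    exact mnorm_action_Haagerup_le X b

end Algebras

section CompletelyBounded

variable {E F G : Type*} [SeminormedAddCommGroup E] [NormedSpace ℂ E] [MatrixNormed E]
  [SeminormedAddCommGroup F] [NormedSpace ℂ F] [MatrixNormed F]
  [SeminormedAddCommGroup G] [NormedSpace ℂ G] [MatrixNormed G]

/-- Complete boundedness of a linear map `f`: its amplifications `f_n : M_n(E) → M_n(F)` are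
bounded by a common constant. -/
def IsCB (f : E →ₗ[ℂ] F) : Prop :=
  ∃ C : ℝ, ∀ (n : ℕ) (x : Matrix (Fin n) (Fin n) E), mnorm (x.map f) ≤ C * mnorm x

theorem IsCB.id : IsCB (LinearMap.id : E →ₗ[ℂ] E) :=
  ⟨1, fun n x => by
    rw [one_mul]
    exact le_of_eq (congrArg _ (by ext; rfl))⟩

theorem IsCB.zero : IsCB (0 : E →ₗ[ℂ] F) :=
  ⟨0, fun n x => by
    have h : x.map (0 : E →ₗ[ℂ] F) = 0 := by ext; rfl
    rw [h, mnorm_zero, zero_mul]⟩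

theorem IsCB.add {f g : E →ₗ[ℂ] F} (hf : IsCB f) (hg : IsCB g) : IsCB (f + g) := by
  obtain ⟨C, hC⟩ := hf
  obtain ⟨D, hD⟩ := hg
  refine ⟨C + D, fun n x => ?_⟩
  have h : x.map (f + g) = x.map f + x.map g := by ext; rfl
  rw [h, add_mul]
  exact (mnorm_add_le _ _).trans (add_le_add (hC n x) (hD n x))

theorem IsCB.neg {f : E →ₗ[ℂ] F} (hf : IsCB f) : IsCB (-f) := by
  obtain ⟨C, hC⟩ := hf
  refine ⟨C, fun n x => ?_⟩
  have h : x.map (-f) = -x.map f := by ext; rfl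
  rw [h, ← rnorm_eq_mnorm, rnorm_neg, rnorm_eq_mnorm]
  exact hC n x

theorem IsCB.comp {g : F →ₗ[ℂ] G} {f : E →ₗ[ℂ] F} (hg : IsCB g) (hf : IsCB f) :
    IsCB (g.comp f) := by
  obtain ⟨C, hC⟩ := hf
  obtain ⟨D, hD⟩ := hg
  refine ⟨max D 0 * C, fun n x => ?_⟩
  have h : x.map (g.comp f) = (x.map f).map g := by ext; rfl
  rw [h, mul_assoc]
  refine (hD n _).trans ?_
  exact (mul_le_mul_of_nonneg_right (le_max_left D 0) (mnorm_nonneg _)).trans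
    (mul_le_mul_of_nonneg_left (hC n x) (le_max_right D 0))

variable (E F)

/-- The completely bounded linear maps `E → F`. -/
def CB : AddSubgroup (E →ₗ[ℂ] F) where
  carrier := {f | IsCB f}
  zero_mem' := IsCB.zero
  add_mem' := IsCB.add
  neg_mem' := IsCB.neg

/-- The completely bounded right `A`-module maps `E → F`. -/
def CBMod (A : Type*) [Ring A] [Module Aᵐᵒᵖ E] [Module Aᵐᵒᵖ F] : AddSubgroup (E →ₗ[ℂ] F) where
  carrier := {f | IsCB f ∧ ∀ (a : A) (x : E), f (MulOpposite.op a • x) = MulOpposite.op a • f x}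
  zero_mem' := ⟨IsCB.zero, fun a x => by simp⟩
  add_mem' := fun hf hg => ⟨hf.1.add hg.1, fun a x => by simp [hf.2, hg.2]⟩
  neg_mem' := fun hf => ⟨hf.1.neg, fun a x => by simp [hf.2]⟩

end CompletelyBounded

section Categories

open CategoryTheory Limits

/-- The objects of `Op`: operator spaces (complete, with matrix norms satisfying Ruan's axioms). -/
structure OpSpace : Type (u + 1) where
  carrier : Type u
  [normedAddCommGroup : NormedAddCommGroup carrier]
  [normedSpace : NormedSpace ℂ carrier]
  [completeSpace : CompleteSpace carrier]
  [matrixNormed : MatrixNormed carrier]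

attribute [instance] OpSpace.normedAddCommGroup OpSpace.normedSpace OpSpace.completeSpace
  OpSpace.matrixNormed

/-- The category `Op` of operator spaces and completely bounded linear maps. -/
instance : Category.{u} OpSpace.{u} where
  Hom E F := CB E.carrier F.carrier
  id E := ⟨LinearMap.id, IsCB.id⟩
  comp f g := ⟨g.1.comp f.1, g.2.comp f.2⟩

instance : Preadditive OpSpace.{u} where
  homGroup E F := inferInstanceAs (AddCommGroup (CB E.carrier F.carrier))
  add_comp _ _ _ f f' g := Subtype.ext (LinearMap.comp_add f.1 f'.1 g.1)
  comp_add _ _ _ f g g' := Subtype.ext (LinearMap.add_comp f.1 g'.1 g.1)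

variable (A : Type u) [NormedRing A] [NormedAlgebra ℂ A] [MatrixNormed A]

/-- The objects of `OMOD_A` for a unital operator algebra `A`: right operator `A`-modules. They
are unital, as `Module Aᵐᵒᵖ` contains `x · 1 = x`; so they are non-degenerate. -/
structure OMod : Type (u + 1) where
  carrier : Type u
  [normedAddCommGroup : NormedAddCommGroup carrier]
  [normedSpace : NormedSpace ℂ carrier]
  [completeSpace : CompleteSpace carrier]
  [matrixNormed : MatrixNormed carrier]
  [module : Module Aᵐᵒᵖ carrier]
  [isScalarTower : IsScalarTower ℂ Aᵐᵒᵖ carrier]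
  [operatorModule : OperatorModule A carrier]

attribute [instance] OMod.normedAddCommGroup OMod.normedSpace OMod.completeSpace
  OMod.matrixNormed OMod.module OMod.isScalarTower OMod.operatorModule

/-- The category `OMOD_A` of right operator `A`-modules and completely bounded `A`-module maps. -/
instance : Category.{u} (OMod A) where
  Hom E F := CBMod E.carrier F.carrier A
  id E := ⟨LinearMap.id, IsCB.id, fun _ _ => rfl⟩
  comp f g := ⟨g.1.comp f.1, g.2.1.comp f.2.1, fun a x => by
    rw [LinearMap.comp_apply, f.2.2, g.2.2, LinearMap.comp_apply]⟩

instance : Preadditive (OMod A) where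
  homGroup E F := inferInstanceAs (AddCommGroup (CBMod E.carrier F.carrier A))
  add_comp _ _ _ f f' g := Subtype.ext (LinearMap.comp_add f.1 f'.1 g.1)
  comp_add _ _ _ f g g' := Subtype.ext (LinearMap.add_comp f.1 g'.1 g.1)

/-- The forgetful functor from `OMOD_A` to `Op`. -/
def forgetOp : OMod A ⥤ OpSpace.{u} where
  obj E := { carrier := E.carrier }
  map f := ⟨f.1, f.2.1⟩

instance : (forgetOp A).Additive where
  map_add := rfl

/-- `(μ, π)` is a kernel-cokernel pair: `μ` is a kernel of `π` and `π` is a cokernel of `μ`. -/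
def IsKernelCokernelPair {C : Type*} [Category C] [HasZeroMorphisms C] (S : ShortComplex C) :
    Prop :=
  Nonempty (IsLimit (KernelFork.ofι S.f S.zero)) ∧
    Nonempty (IsColimit (CokernelCofork.ofπ S.g S.zero))

/-- The class `E_rel` of the kernel-cokernel pairs in `OMOD_A` that split in `Op`. -/
def relPairs : Set (ShortComplex (OMod A)) :=
  {S | IsKernelCokernelPair S ∧ Nonempty (S.map (forgetOp A)).Splitting}

/-- The admissible epimorphisms of a class of kernel-cokernel pairs: the morphisms `π` for which
there is a morphism `μ` such that `(μ, π)` belongs to the class. -/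
def admissibleEpi {C : Type*} [Category C] [HasZeroMorphisms C] (𝓔 : Set (ShortComplex C)) :
    MorphismProperty C :=
  fun E _ π => ∃ (K : C) (μ : K ⟶ E) (w : μ ≫ π = 0), ShortComplex.mk μ π w ∈ 𝓔

/-- `P`-projectivity of an object for a class `P` of morphisms: every morphism from the object to
`F` lifts along every `π : E ⟶ F` in `P`. -/
def IsRelProjective {C : Type*} [Category C] (P : MorphismProperty C) (X : C) : Prop :=
  ∀ ⦃E F : C⦄ (π : E ⟶ F), P π → ∀ f : X ⟶ F, ∃ g : X ⟶ E, g ≫ π = f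

/-- Enough `P`-projectives: every object `E` admits a morphism `X ⟶ E` in `P` from a
`P`-projective object `X`. -/
def EnoughRelProjectives {C : Type*} [Category C] (P : MorphismProperty C) : Prop :=
  ∀ E : C, ∃ X : C, IsRelProjective P X ∧ ∃ π : X ⟶ E, P π

/-- The Haagerup tensor product `E ⊗_h A`, as a right operator `A`-module with the action
`(x ⊗ a) · b = x ⊗ ab`. -/
noncomputable def haagerupMod [OperatorAlgebra A] (E : OpSpace.{u}) : OMod A where
  carrier := Haagerup E.carrier A

end Categories

end OperatorModules

namespace OperatorModules

open MatrixNormed MulOpposite UniformSpace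

/-! ### Completely bounded maps: rectangular matrices, continuity, extension to completions -/

section CompletelyBoundedMaps

variable {E F : Type*} [SeminormedAddCommGroup E] [NormedSpace ℂ E] [MatrixNormed E]
  [SeminormedAddCommGroup F] [NormedSpace ℂ F] [MatrixNormed F]

/-! The module `E ⊗_h A` is free on the operator space `E`. Every completely bounded linear map `h :
E → M` into a right operator module is restriction along `x ↦ x ⊗ 1` of a completely bounded module
map `x ⊗ a ↦ h x · a` on `E ⊗_h A` (`IsCB.exists_lift`). The estimate is made on one factorization
`x ⊙ y` at a time: amplifying `h` costs its bound `C`, and the action of `A` on `M` is completely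
contractive. The map then extends to the completion. Conversely, `x ↦ x ⊗ 1` is itself completely
bounded (`isCB_tmulOne`), because the identity of `M_n(A)` has norm at most one.

The class `P_rel` consists exactly of the module maps with a completely bounded linear section,
which need not be a module map. A splitting in `Op` contains such a section
(`exists_section_of_admissibleEpi`). Conversely, a section `σ` of `π` makes `id - σπ` a completely
bounded projection onto the kernel, which is a closed submodule and a right operator module with the
inherited norms; every module map that vanishes on the kernel then factors uniquely through `π`, by
composition with `σ` (`admissibleEpi_of_section`).

Projectivity follows: given `f : E ⊗_h A → G` and a section `σ` of `π : F → G`, the linear map `x ↦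
σ (f (x ⊗ 1))` induces a module map `g` into `F`, and `πg` agrees with `f` on elementary tensors
because both are module maps. The canonical map onto a module is the one induced by the identity,
and `x ↦ x ⊗ 1` is its section. Applied to the underlying operator space of a given module, these
two facts provide enough projectives. -/

theorem IsCB.exists_nonneg {f : E →ₗ[ℂ] F} (hf : IsCB f) : ∃ C : ℝ, 0 ≤ C ∧
    ∀ (n : ℕ) (x : Matrix (Fin n) (Fin n) E), mnorm (x.map f) ≤ C * mnorm x := by
  obtain ⟨C, hC⟩ := hf
  exact ⟨max C 0, le_max_right _ _, fun n x => (hC n x).trans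
    (mul_le_mul_of_nonneg_right (le_max_left _ _) (mnorm_nonneg _))⟩

/-- This is the case `n = 1`, where the matrix norm is the norm of the space. -/
theorem norm_le_of_mnorm_map_le {f : E →ₗ[ℂ] F} {C : ℝ}
    (hC : ∀ (n : ℕ) (x : Matrix (Fin n) (Fin n) E), mnorm (x.map f) ≤ C * mnorm x) (x : E) :
    ‖f x‖ ≤ C * ‖x‖ := by
  have h := hC 1 (Matrix.of fun _ _ => x)
  rwa [mnorm_one, mnorm_one] at h

theorem IsCB.continuous {f : E →ₗ[ℂ] F} (hf : IsCB f) : Continuous f := by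
  obtain ⟨C, hC⟩ := hf
  exact (f.mkContinuous C (norm_le_of_mnorm_map_le hC)).continuous

/-- Padding by zeros is multiplication by scalar matrices, so it commutes with entrywise linear maps
and the bound for square matrices carries over with the same constant. Rectangular matrices matter
because they are the factors in the Haagerup norm. -/
theorem rnorm_map_le {f : E →ₗ[ℂ] F} {C : ℝ}
    (hC : ∀ (n : ℕ) (x : Matrix (Fin n) (Fin n) E), mnorm (x.map f) ≤ C * mnorm x)
    {ι κ : Type} [Fintype ι] [Fintype κ] [DecidableEq ι] [DecidableEq κ] (x : Matrix ι κ E) :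
    rnorm (x.map f) ≤ C * rnorm x := by
  have h : pad (x.map f) = (pad x).map f := by
    rw [pad_eq_lr, pad_eq_lr, lr_map]
  unfold rnorm
  rw [h]
  exact hC _ _

/-- The extension of a completely bounded map to the completion of its domain. -/
theorem IsCB.exists_extension {V M : Type*} [SeminormedAddCommGroup V] [NormedSpace ℂ V]
    [MatrixNormed V] [NormedAddCommGroup M] [NormedSpace ℂ M] [CompleteSpace M] [MatrixNormed M]
    {f : V →ₗ[ℂ] M} (hf : IsCB f) :
    ∃ g : Completion V →ₗ[ℂ] M, IsCB g ∧ ∀ v : V, g (v : Completion V) = f v := by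
  obtain ⟨C, hC⟩ := hf
  let f' : V →L[ℂ] M := f.mkContinuous C (norm_le_of_mnorm_map_le hC)
  let g : Completion V →L[ℂ] M := f'.extend (Completion.toComplL (𝕜 := ℂ) (E := V))
  have hg : ∀ v : V, g (v : Completion V) = f v := fun v =>
    ContinuousLinearMap.extend_eq f' Completion.denseRange_coe
      (Completion.isUniformInducing_coe V) v
  refine ⟨g, ⟨C, fun n x => ?_⟩, hg⟩
  -- The inequality is a closed condition on the matrix, and matrices with entries in `V` are dense.
  refine cmap_denseRange.induction_on
    (p := fun x : Matrix (Fin n) (Fin n) (Completion V) => mnorm (x.map g) ≤ C * mnorm x) x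
    (isClosed_le (uniformContinuous_mnorm.continuous.comp
      (continuous_id.matrix_map g.continuous))
      (continuous_const.mul uniformContinuous_mnorm.continuous)) fun x => ?_
  have h : (cmap x).map g = x.map f := by
    ext i j
    exact hg _
  rw [h, mnorm_cmap]
  exact hC n x

end CompletelyBoundedMaps

/-! ### Maps into and out of the Haagerup tensor product -/

section HaagerupMaps

variable {A : Type*} [NormedRing A] [NormedAlgebra ℂ A] [MatrixNormed A]
variable {E : Type*} [SeminormedAddCommGroup E] [NormedSpace ℂ E] [MatrixNormed E]

/-- The identity of size `n + 1` is the direct sum of the identity of size `n` and the `1 × 1`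
identity, and direct sums have the maximum of the two norms. -/
theorem mnorm_diagonal_one_le [OperatorAlgebra A] (n : ℕ) :
    mnorm (1 : Matrix (Fin n) (Fin n) A) ≤ 1 := by
  induction n with
  | zero =>
    rw [Subsingleton.elim (1 : Matrix (Fin 0) (Fin 0) A) 0, mnorm_zero]
    exact zero_le_one
  | succ n ih =>
    have h : (1 : Matrix (Fin (n + 1)) (Fin (n + 1)) A) =
        dsum (1 : Matrix (Fin n) (Fin n) A) (1 : Matrix (Fin 1) (Fin 1) A) := by
      rw [dsum, Matrix.fromBlocks_one, Matrix.submatrix_one_equiv]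
    rw [h, mnorm_dsum, mnorm_one]
    exact max_le ih (by simpa using OperatorAlgebra.norm_one_le)

/-- The map `E → E ⊗_h A`, `x ↦ x ⊗ 1`. -/
noncomputable def tmulOne (A E : Type*) [NormedRing A] [NormedAlgebra ℂ A] [MatrixNormed A]
    [SeminormedAddCommGroup E] [NormedSpace ℂ E] [MatrixNormed E] : E →ₗ[ℂ] Haagerup E A :=
  (Completion.toComplL (𝕜 := ℂ) (E := HTensor E A) : HTensor E A →ₗ[ℂ] Haagerup E A).comp
    (show E →ₗ[ℂ] HTensor E A from (TensorProduct.mk ℂ E A).flip 1)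

theorem tmulOne_apply (x : E) : tmulOne A E x = Haagerup.tmul x 1 := rfl

/-- The amplified map sends `x` to `x ⊙ 1`, with `1` the identity of `M_n(A)`. This factorization
bounds the Haagerup norm by `‖x‖ ‖1‖ ≤ ‖x‖`, so the map is in fact completely contractive. -/
theorem isCB_tmulOne [OperatorAlgebra A] : IsCB (tmulOne A E) := by
  refine ⟨1, fun n x => ?_⟩
  have h : x.map (tmulOne A E) = cmap (hodot x (1 : Matrix (Fin n) (Fin n) A)) := by
    ext i j
    have e : odot x (1 : Matrix (Fin n) (Fin n) A) i j = x i j ⊗ₜ[ℂ] 1 := by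
      rw [odot_apply, Finset.sum_eq_single j]
      · simp
      · intro k _ hk
        simp [Matrix.one_apply_ne hk]
      · simp
    exact congrArg (fun u : HTensor E A => (u : Haagerup E A)) e.symm
  rw [h, mnorm_cmap, one_mul]
  refine (mnorm_hodot_le _ _).trans ?_
  rw [rnorm_eq_mnorm, rnorm_eq_mnorm]
  exact mul_le_of_le_one_right (mnorm_nonneg _) (mnorm_diagonal_one_le n)

/-- Two continuous linear maps on `E ⊗_h A` agree if they agree on elementary tensors. -/
theorem Haagerup.ext_of_tmul {M : Type*} [NormedAddCommGroup M] [NormedSpace ℂ M]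
    {f g : Haagerup E A →ₗ[ℂ] M} (hf : Continuous f) (hg : Continuous g)
    (h : ∀ (x : E) (a : A), f (Haagerup.tmul x a) = g (Haagerup.tmul x a)) : f = g := by
  -- Elementary tensors span the algebraic tensor product, which is dense in its completion.
  have key : f.comp (Completion.toComplL (𝕜 := ℂ) (E := HTensor E A) :
        HTensor E A →ₗ[ℂ] Haagerup E A) =
      g.comp (Completion.toComplL (𝕜 := ℂ) (E := HTensor E A) :
        HTensor E A →ₗ[ℂ] Haagerup E A) :=
    TensorProduct.ext' (R := ℂ) (M := E) (N := A) h
  refine LinearMap.ext fun u => ?_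
  refine Completion.induction_on u (isClosed_eq hf hg) fun v => ?_
  exact DFunLike.congr_fun key v

variable {M : Type*} [NormedAddCommGroup M] [NormedSpace ℂ M] [MatrixNormed M]
  [Module Aᵐᵒᵖ M] [IsScalarTower ℂ Aᵐᵒᵖ M]

/-- The action of `b : A` on a right module, as a linear map. -/
def opSMul (M : Type*) [AddCommGroup M] [Module ℂ M] [Module Aᵐᵒᵖ M] [IsScalarTower ℂ Aᵐᵒᵖ M]
    (b : A) : M →ₗ[ℂ] M where
  toFun x := op b • x
  map_add' := smul_add _
  -- Compatibility of the complex scalars with the action is already part of the linearity of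
  -- `actionMap`, since `c • (x ⊗ b)` unfolds to `(c • x) ⊗ b`.
  map_smul' c x := (actionMap A M).map_smul c (x ⊗ₜ[ℂ] b)

/-- Complete contractivity of the action, read on `1 × 1` matrices, gives `‖x · b‖ ≤ ‖x‖ ‖b‖`. -/
theorem continuous_op_smul [OperatorModule A M] (b : A) :
    Continuous fun x : M => op b • x := by
  refine ((opSMul M b).mkContinuous ‖b‖ fun x => ?_).continuous
  have h := rnorm_map_odot_le (actionMap A M) OperatorModule.mnorm_action_le
    (Matrix.of fun _ _ : Fin 1 => x) (Matrix.of fun _ _ : Fin 1 => b)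
  rw [rnorm_eq_mnorm, rnorm_eq_mnorm, rnorm_eq_mnorm, mnorm_one, mnorm_one, mnorm_one,
    map_actionMap_odot] at h
  change ‖op b • x‖ ≤ _
  simpa [mul_comm] using h

/-- A completely bounded map `h : E → M` into a right operator module induces the completely
bounded module map `E ⊗_h A → M`, `x ⊗ a ↦ h x · a`. -/
theorem IsCB.exists_lift [OperatorAlgebra A] [CompleteSpace M] [OperatorModule A M]
    {h : E →ₗ[ℂ] M} (hh : IsCB h) :
    ∃ g : Haagerup E A →ₗ[ℂ] M, g ∈ CBMod (Haagerup E A) M A ∧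
      ∀ (x : E) (a : A), g (Haagerup.tmul x a) = op a • h x := by
  obtain ⟨C, hC0, hC⟩ := hh.exists_nonneg
  let f : E ⊗[ℂ] A →ₗ[ℂ] M := (actionMap A M).comp (LinearMap.rTensor A h)
  have hf : ∀ (n : ℕ) (u : Matrix (Fin n) (Fin n) (E ⊗[ℂ] A)), mnorm (u.map f) ≤ C * hnorm u := by
    intro n u
    -- As `C ≥ 0`, it can be moved inside the infimum, so one factorization `u = x ⊙ y` can be
    -- treated at a time.
    rw [← smul_eq_mul, hnorm, ← Real.sInf_smul_of_nonneg hC0]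
    refine le_csInf (Set.Nonempty.smul_set (hnorm_nonempty u)) ?_
    rintro _ ⟨_, ⟨p, x, y, rfl, rfl⟩, rfl⟩
    -- Applying `h` only affects the left factor, so what remains is the action on `h(x) ⊙ y`.
    have e : (odot x y).map f = (odot (x.map h) y).map (actionMap A M) := by
      ext i j
      rw [map_actionMap_odot]
      change (actionMap A M).comp (LinearMap.rTensor A h) (odot x y i j) = _
      rw [odot_apply, map_sum]
      rfl
    have h1 : mnorm ((odot x y).map f) ≤ rnorm (x.map h) * rnorm y := by
      rw [e, ← rnorm_eq_mnorm]
      exact rnorm_map_odot_le _ OperatorModule.mnorm_action_le _ _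
    refine h1.trans ?_
    change _ ≤ C * (rnorm x * rnorm y)
    rw [← mul_assoc]
    exact mul_le_mul_of_nonneg_right (rnorm_map_le hC x) (rnorm_nonneg _)
  obtain ⟨g, hg, hgf⟩ := IsCB.exists_extension (V := HTensor E A) (f := f) ⟨C, hf⟩
  have ht : ∀ (x : E) (a : A), g (Haagerup.tmul x a) = op a • h x := fun x a => hgf _
  refine ⟨g, ⟨hg, fun a u => ?_⟩, ht⟩
  -- For fixed `a`, the module law is an equality of two continuous linear maps, hence can be tested
  -- on elementary tensors, where it is associativity of the action.
  have key : g.comp (opSMul (Haagerup E A) a) = (opSMul M a).comp g := by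
    refine Haagerup.ext_of_tmul (hg.continuous.comp (continuous_op_smul a))
      ((continuous_op_smul a).comp hg.continuous) fun x b => ?_
    change g (op a • Haagerup.tmul x b) = op a • g (Haagerup.tmul x b)
    rw [Haagerup.op_smul_tmul, ht, ht, op_mul, mul_smul]
  exact DFunLike.congr_fun key u

end HaagerupMaps

/-! ### Subspaces of operator spaces -/

section Submodules

/-- The matrix norms on a subspace of an operator space. -/
instance {E : Type*} [SeminormedAddCommGroup E] [NormedSpace ℂ E] [MatrixNormed E]
    (K : Submodule ℂ E) : MatrixNormed K where
  mnorm x := mnorm (x.map K.subtype)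
  mnorm_one x := mnorm_one _
  mnorm_add_le x y := by
    rw [Matrix.map_add _ (map_add _)]
    exact mnorm_add_le _ _
  mnorm_lr_le α x β := by
    rw [lr_map]
    exact mnorm_lr_le _ _ _
  mnorm_dsum x y := by
    rw [← mnorm_dsum]
    congr 1
    unfold dsum
    rw [← Matrix.submatrix_map, Matrix.fromBlocks_map]
    simp

theorem rnorm_map_subtype {E : Type*} [SeminormedAddCommGroup E] [NormedSpace ℂ E]
    [MatrixNormed E] (K : Submodule ℂ E) {ι κ : Type} [Fintype ι] [Fintype κ] [DecidableEq ι]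
    [DecidableEq κ] (x : Matrix ι κ K) : rnorm (x.map K.subtype) = rnorm x := by
  unfold rnorm
  rw [pad_eq_lr, ← lr_map, ← pad_eq_lr]
  rfl

end Submodules

/-! ### Kernels in `OMOD_A` -/

section Kernels

open CategoryTheory Limits

variable {A : Type u} [NormedRing A] [NormedAlgebra ℂ A] [MatrixNormed A]

/-- The right `A`-module structure of the kernel of a morphism of `OMOD_A`. -/
instance kerModule {E F : OMod A} (π : E ⟶ F) : Module Aᵐᵒᵖ (LinearMap.ker π.1) where
  smul a x := ⟨a • x.1, by
    have h := π.2.2 a.unop x.1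
    rw [LinearMap.mem_ker.1 x.2, smul_zero] at h
    exact h⟩
  one_smul x := Subtype.ext (one_smul _ x.1)
  mul_smul a b x := Subtype.ext (mul_smul a b x.1)
  smul_zero a := Subtype.ext (smul_zero a)
  smul_add a x y := Subtype.ext (smul_add a x.1 y.1)
  add_smul a b x := Subtype.ext (add_smul a b x.1)
  zero_smul x := Subtype.ext (zero_smul _ x.1)

instance {E F : OMod A} (π : E ⟶ F) : IsScalarTower ℂ Aᵐᵒᵖ (LinearMap.ker π.1) where
  smul_assoc c a x := Subtype.ext (smul_assoc c a x.1)

instance {E F : OMod A} (π : E ⟶ F) : OperatorModule A (LinearMap.ker π.1) where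
  mnorm_action_le u := by
    refine le_csInf (hnorm_nonempty u) ?_
    rintro _ ⟨p, x, b, rfl, rfl⟩
    -- The inclusion commutes with the action and preserves all matrix norms, so the estimate is the
    -- one valid in `E`.
    have h : ((odot x b).map (actionMap A (LinearMap.ker π.1))).map
        (LinearMap.ker π.1).subtype =
        (odot (x.map (LinearMap.ker π.1).subtype) b).map (actionMap A E.carrier) := by
      ext i j
      rw [Matrix.map_apply, map_actionMap_odot, map_actionMap_odot, map_sum]
      rfl
    change mnorm (((odot x b).map (actionMap A (LinearMap.ker π.1))).map
        (LinearMap.ker π.1).subtype) ≤ _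
    rw [h, ← rnorm_map_subtype, ← rnorm_eq_mnorm]
    exact rnorm_map_odot_le _ OperatorModule.mnorm_action_le _ _

/-- The kernel of a morphism of `OMOD_A`. -/
noncomputable def kerMod {E F : OMod A} (π : E ⟶ F) : OMod A where
  carrier := LinearMap.ker π.1
  -- The kernel is closed, being the preimage of `{0}` under a continuous map, hence complete.
  completeSpace := (isClosed_singleton.preimage π.2.1.continuous).completeSpace_coe

/-- The inclusion of the kernel of a morphism of `OMOD_A`. -/
noncomputable def kerι {E F : OMod A} (π : E ⟶ F) : kerMod π ⟶ E :=
  ⟨(LinearMap.ker π.1).subtype, ⟨1, fun _ _ => (one_mul _).ge⟩, fun _ _ => rfl⟩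

theorem kerι_comp {E F : OMod A} (π : E ⟶ F) : kerι π ≫ π = 0 :=
  Subtype.ext (LinearMap.ext fun x => x.2)

theorem hom_ext_apply {E F : OMod A} {f g : E ⟶ F} (h : ∀ x, f.1 x = g.1 x) : f = g :=
  Subtype.ext (LinearMap.ext h)

theorem apply_eq_zero {E F G : OMod A} {f : E ⟶ F} {g : F ⟶ G} (h : f ≫ g = 0)
    (x : E.carrier) : g.1 (f.1 x) = 0 :=
  congrArg (fun k : E ⟶ G => k.1 x) h

/-- The matrix norms of `K` are those of `F`, so the same constant works. -/
theorem isCB_codRestrict {E F : Type*} [SeminormedAddCommGroup E] [NormedSpace ℂ E]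
    [MatrixNormed E] [SeminormedAddCommGroup F] [NormedSpace ℂ F] [MatrixNormed F]
    (K : Submodule ℂ F) {f : E →ₗ[ℂ] F} (hf : IsCB f) (h : ∀ x, f x ∈ K) :
    IsCB (f.codRestrict K h) := by
  obtain ⟨C, hC⟩ := hf
  exact ⟨C, fun n x => hC n x⟩

/-- The inclusion of the kernel of `π` is a kernel of `π` in `OMOD_A`. -/
theorem nonempty_isLimit_kerι {E F : OMod A} (π : E ⟶ F) :
    Nonempty (IsLimit (KernelFork.ofι (kerι π) (kerι_comp π))) :=
  ⟨KernelFork.IsLimit.ofι _ _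
    (fun g hg => ⟨g.1.codRestrict _ (apply_eq_zero hg), isCB_codRestrict _ g.2.1 _,
      fun a x => Subtype.ext (g.2.2 a x)⟩)
    (fun _ _ => rfl)
    (fun _ _ _ hm => hom_ext_apply fun x => Subtype.ext
      (congrArg (fun k => k.1 x) hm))⟩

/-- A morphism of `OMOD_A` that has a completely bounded linear section is a cokernel of the
inclusion of its kernel. -/
theorem nonempty_isColimit_of_section {E F : OMod A} (π : E ⟶ F)
    {σ : F.carrier →ₗ[ℂ] E.carrier} (hσ : IsCB σ) (hπσ : ∀ y, π.1 (σ y) = y) :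
    Nonempty (IsColimit (CokernelCofork.ofπ π (kerι_comp π))) := by
  -- The element `x - σ (π x)` lies in the kernel of `π`, so `g` kills it. Hence `g ∘ σ` is the
  -- factorization of `g` through `π`.
  have key : ∀ {Z : OMod A} (g : E ⟶ Z), kerι π ≫ g = 0 → ∀ x, g.1 (σ (π.1 x)) = g.1 x := by
    intro Z g hg x
    have h := apply_eq_zero hg ⟨x - σ (π.1 x), by
      rw [LinearMap.mem_ker, map_sub, hπσ, sub_self]⟩
    change g.1 (x - σ (π.1 x)) = 0 at h
    rw [map_sub, sub_eq_zero] at h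
    exact h.symm
  refine ⟨CokernelCofork.IsColimit.ofπ _ _
    (fun {Z} g hg => ⟨g.1.comp σ, g.2.1.comp hσ, fun a y => ?_⟩)
    (fun {Z} g hg => hom_ext_apply (key g hg))
    (fun {Z} g hg m hm => hom_ext_apply fun y => ?_)⟩
  -- Although `σ` need not respect the action, `g ∘ σ` does: `σ y · a` is mapped by `π` to `y · a`,
  -- so `key` identifies `g (σ (y · a))` with `g (σ y · a) = g (σ y) · a`.
  · have h := key g hg (op a • σ y)
    rw [π.2.2, hπσ, g.2.2] at h
    exact h
  -- Uniqueness: since `y = π (σ y)`, the value of any factorization at `y` is forced.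
  · have h : m.1 (π.1 (σ y)) = g.1 (σ y) := congrArg (fun k => k.1 (σ y)) hm
    rw [hπσ] at h
    exact h

/-! ### Admissible epimorphisms and completely bounded sections -/

/-- A morphism of `OMOD_A` that has a completely bounded linear section is an admissible
epimorphism of `E_rel`. -/
theorem admissibleEpi_of_section {E F : OMod A} (π : E ⟶ F)
    {σ : F.carrier →ₗ[ℂ] E.carrier} (hσ : IsCB σ) (hπσ : ∀ y, π.1 (σ y) = y) :
    admissibleEpi (relPairs A) π := by
  refine ⟨kerMod π, kerι π, kerι_comp π,
    ⟨nonempty_isLimit_kerι π, nonempty_isColimit_of_section π hσ hπσ⟩, ⟨?_⟩⟩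
  -- The projection onto the kernel along the range of `σ`; with its codomain restricted, it is the
  -- retraction of the splitting.
  let r : E.carrier →ₗ[ℂ] E.carrier := LinearMap.id + -(σ.comp π.1)
  have hr : IsCB r := IsCB.id.add (hσ.comp π.2.1).neg
  have hmem : ∀ x, r x ∈ LinearMap.ker π.1 := fun x => by
    rw [LinearMap.mem_ker, LinearMap.add_apply, LinearMap.neg_apply, LinearMap.comp_apply,
      LinearMap.id_apply, map_add, map_neg, hπσ, add_neg_cancel]
  exact
    { r := ⟨r.codRestrict _ hmem, isCB_codRestrict _ hr _⟩
      s := ⟨σ, hσ⟩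
      f_r := Subtype.ext (LinearMap.ext fun x => Subtype.ext (by
        change x.1 + -σ (π.1 x.1) = x.1
        rw [LinearMap.mem_ker.1 x.2, map_zero, neg_zero, add_zero]))
      s_g := Subtype.ext (LinearMap.ext hπσ)
      id := Subtype.ext (LinearMap.ext fun (x : E.carrier) =>
        neg_add_cancel_right x (σ (π.1 x))) }

/-- An admissible epimorphism of `E_rel` has a completely bounded linear section. -/
theorem exists_section_of_admissibleEpi {E F : OMod A} {π : E ⟶ F}
    (h : admissibleEpi (relPairs A) π) :
    ∃ σ : F.carrier →ₗ[ℂ] E.carrier, IsCB σ ∧ ∀ y, π.1 (σ y) = y := by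
  obtain ⟨K, μ, w, -, ⟨s⟩⟩ := h
  exact ⟨s.s.1, s.s.2, fun y => DFunLike.congr_fun (congrArg Subtype.val s.s_g) y⟩

/-! ### Relative projectivity and the canonical epimorphism -/

/-- A module map out of `E ⊗_h A` is determined by its values on `x ⊗ 1`, and these may be
prescribed by any completely bounded linear map. A linear section of `π` is therefore enough to lift
`f`. -/
theorem isRelProjective_haagerupMod [OperatorAlgebra A] (E : OpSpace.{u}) :
    IsRelProjective (admissibleEpi (relPairs A)) (haagerupMod A E) := by
  intro F G π hπ f
  obtain ⟨σ, hσ, hπσ⟩ := exists_section_of_admissibleEpi hπ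
  -- The map `f` with its domain displayed as the Haagerup tensor product, so that the lemmas on
  -- that space apply.
  let f₀ : Haagerup E.carrier A →ₗ[ℂ] G.carrier := f.1
  have hf₀ : IsCB f₀ := f.2.1
  -- The lift is induced by `x ↦ σ (f (x ⊗ 1))`, that is, `g (x ⊗ a) = σ (f (x ⊗ 1)) · a`.
  obtain ⟨g, hg, hgt⟩ := ((hσ.comp hf₀).comp (isCB_tmulOne (A := A))).exists_lift (A := A)
  refine ⟨⟨g, hg⟩, Subtype.ext ?_⟩
  refine Haagerup.ext_of_tmul (f := π.1.comp g) (g := f₀)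
    (π.2.1.continuous.comp hg.1.continuous) hf₀.continuous fun x a => ?_
  -- As `f` is a module map, `f (x ⊗ a) = f (x ⊗ 1) · a`; this equals `π (g (x ⊗ a))`, because `π`
  -- is a module map with `πσ = id`.
  have h1 : f₀ (op a • Haagerup.tmul x 1) = op a • f₀ (Haagerup.tmul x 1) := f.2.2 a _
  rw [Haagerup.op_smul_tmul, one_mul] at h1
  rw [LinearMap.comp_apply, hgt, π.2.2, LinearMap.comp_apply, LinearMap.comp_apply, hπσ,
    tmulOne_apply, h1]

/-- The map is induced by the identity of `E`. It has the completely bounded section `x ↦ x ⊗ 1`,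
since the module is unital. -/
theorem exists_admissibleEpi_haagerupMod [OperatorAlgebra A] (E : OMod A) :
    ∃ P : haagerupMod A ((forgetOp A).obj E) ⟶ E,
      (∀ (x : E.carrier) (a : A), P.1 (Haagerup.tmul x a) = MulOpposite.op a • x) ∧
      admissibleEpi (relPairs A) P := by
  obtain ⟨g, hg, hgt⟩ := (IsCB.id (E := E.carrier)).exists_lift (A := A)
  refine ⟨⟨g, hg⟩, hgt, admissibleEpi_of_section _ (σ := tmulOne A E.carrier) isCB_tmulOne
    fun y => ?_⟩
  change g (Haagerup.tmul y 1) = y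
  rw [hgt, op_one, one_smul, LinearMap.id_apply]

end Kernels

end OperatorModules

open OperatorModules CategoryTheory in
/-- For a unital operator algebra `A` and an operator space `E`, the module `E ⊗_h A` is
`P_rel`-projective; for `E` in `OMOD_A` the canonical map `E ⊗_h A ⟶ E`, `x ⊗ a ↦ x · a`, is a
morphism of `OMOD_A` and an admissible epimorphism of `E_rel`; and `(OMOD_A, E_rel)` has enough
`P_rel`-projectives. -/
theorem mainTheorem5 {A : Type u} [NormedRing A] [NormedAlgebra ℂ A] [CompleteSpace A]
    [MatrixNormed A] [OperatorAlgebra A] :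
    (∀ E : OpSpace.{u}, IsRelProjective (admissibleEpi (relPairs A)) (haagerupMod A E)) ∧
    (∀ E : OMod A, ∃ P : haagerupMod A ((forgetOp A).obj E) ⟶ E,
      (∀ (x : E.carrier) (a : A), P.1 (Haagerup.tmul x a) = MulOpposite.op a • x) ∧
      admissibleEpi (relPairs A) P) ∧
    EnoughRelProjectives (admissibleEpi (relPairs A)) := by
  refine ⟨isRelProjective_haagerupMod, exists_admissibleEpi_haagerupMod, fun E => ?_⟩
  obtain ⟨P, -, hP⟩ := exists_admissibleEpi_haagerupMod E
  exact ⟨_, isRelProjective_haagerupMod _, P, hP⟩
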